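/- Let $d \ge 0$ be an integer and let $K_0 \subset \mathbb{C}^d$ be a compact neighbourhood of $0$ which is absolutely convex, i.e. $ax+by \in K_0$ for all $x,y\in K_0$ and $a,b\in\mathbb{C}$ with $|a|+|b|\le 1$. Write $|z|_{K_0} := \inf\{r>0 : z \in rK_0\}$ for its Minkowski functional. Let $g: K_0 \to \mathbb{C}$ be analytic (i.e. $g$ extends holomorphically to an open neighbourhood of $K_0$), let $\mu$ be a Borel probability measure on $K_0 \cap \mathbb{R}^d$ absolutely continuous with respect to Lebesgue measure, and let $K_1$ be a compact set contained in the interior of $K_0$. For $n \ge 0$ let $r_n$ be the number of multi-indices $\alpha \in \mathbb{Z}_{\ge 0}^d$ with $|\alpha| \le n$, and let $\Lambda_n(\mu)$ be the smallest eigenvalue of the moment matrix $\big(\int x^{\alpha+\beta}\,d\mu(x)\big)_{|\alpha|,|\beta|\le n}$. Put $$R_\mu := \sup_{x\in \mathrm{supp}(\mu)}|x|_{K_0},\qquad R_{K_1} := \sup_{z \in K_1}|z|_{K_0},\qquad L_\mu := \max\Big(1, \sup_{x \in \mathrm{supp}(\mu)}\max_{i}|x_i|\Big)$$ (a supremum over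 the empty set is $0$, and $0^0=1$). For points $x^1,\dots,x^N \in K_0\cap\mathbb{R}^d$, a least-squares polynomial of degree $n$ is a polynomial $\sum_{|\alpha|\le n} c_\alpha x^\alpha$ with complex coefficients that minimizes $\sum_{i=1}^N |P(x^i)-g(x^i)|^2$ among all polynomials $P$ with $\deg P \le n$; for $m \le n$ its truncation is $\widehat P_{m,n,N}(x) := \sum_{|\alpha|\le m} c_\alpha x^\alpha$. Then there is a constant $C'>0$ depending only on $g$, $K_0$, $K_1$ and $\mu$ such that the following two statements hold. (1) Let $\{x^i\}_{i=1}^\infty \subset K_0\cap\mathbb{R}^d$ be such that $N^{-1}\sum_{i=1}^N\delta_{x^i}$ converges weakly to $\mu$ as $N\to\infty$. Then for all integers $0 \le m \le n$ and every choice, for each $N$, of a least-squares polynomial of degree $n$ for the data $(x^1,g(x^1)),\dots,(x^N,g(x^N))$, $$\limsup_{N\to\infty}\ \sup_{z\in K_1}\big|\widehat P_{m,n,N}(z)-g(z)\big| \le C'\left(\sqrt{m!}\cdot\frac{R_\mu^n}{\Lambda_n(\mu)^{1/2}} + R_{K_1}^m\right).$$ (2) Let $\delta\in(0,1)$, let $0\le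 m\le n$ and $N \ge 0$ be integers with $$N \ge \frac{L_\mu^{4n}\, r_n^2}{\Lambda_n(\mu)^2}\cdot 4\log(2/\delta),$$ and let $x^1,\dots,x^N$ be i.i.d. random variables with distribution $\mu$. Then, with probability at least $1-\delta$ (i.e. on a measurable event of probability at least $1-\delta$), every least-squares polynomial of degree $n$ for the data $(x^1,g(x^1)),\dots,(x^N,g(x^N))$ satisfies $$\sup_{z\in K_1}\big|\widehat P_{m,n,N}(z)-g(z)\big| \le C'\left(\sqrt{2\,m!}\cdot\frac{R_\mu^n}{\Lambda_n(\mu)^{1/2}} + R_{K_1}^m\right).$$ -/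

import Mathlib

open MeasureTheory ProbabilityTheory Filter Topology
open scoped ENNReal

noncomputable section

namespace LSApprox

/-- The inclusion of `ℝ^d` into `ℂ^d`. -/
def toComplex {d : ℕ} (x : Fin d → ℝ) : Fin d → ℂ := fun i => (x i : ℂ)

/-- The set `K ∩ ℝ^d`, as a subset of `ℝ^d`. -/
def realPart {d : ℕ} (K : Set (Fin d → ℂ)) : Set (Fin d → ℝ) := {x | toComplex x ∈ K}

/-- Absolute convexity over `ℂ`. -/
def IsAbsConvex {d : ℕ} (K : Set (Fin d → ℂ)) : Prop :=
  ∀ x ∈ K, ∀ y ∈ K, ∀ a b : ℂ, ‖a‖ + ‖b‖ ≤ 1 → a • x + b • y ∈ K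

/-- The multi-indices `α ∈ ℤ_{≥0}^d` with `|α| ≤ n`. (Every component of such an `α` is at
most `n`, so that the components may be taken in `Fin (n + 1)`.) -/
abbrev MultiIndex (d n : ℕ) : Type := {α : Fin d → Fin (n + 1) // ∑ i, (α i : ℕ) ≤ n}

/-- The number `r_n` of multi-indices of length at most `n`. -/
def numMultiIndex (d n : ℕ) : ℕ := Fintype.card (MultiIndex d n)

/-- The Hankel moment matrix `D_n(μ) = (∫ x^(α + β) dμ(x))_{|α|, |β| ≤ n}`. -/
def momentMatrix {d : ℕ} (n : ℕ) (μ : Measure (Fin d → ℝ)) :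
    Matrix (MultiIndex d n) (MultiIndex d n) ℝ :=
  Matrix.of fun α β => ∫ x, ∏ i, x i ^ ((α.1 i : ℕ) + (β.1 i : ℕ)) ∂μ

theorem momentMatrix_isHermitian {d : ℕ} (n : ℕ) (μ : Measure (Fin d → ℝ)) :
    (momentMatrix n μ).IsHermitian := by
  ext α β
  simp [momentMatrix, add_comm]

/-- `Λ_n(μ)`, the smallest eigenvalue of the moment matrix `D_n(μ)`. -/
def minEigenvalue {d : ℕ} (n : ℕ) (μ : Measure (Fin d → ℝ)) : ℝ :=
  ⨅ α, (momentMatrix_isHermitian n μ).eigenvalues α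

/-- `sup_{z ∈ S} |z|_K`, where `|z|_K = inf {r > 0 : z ∈ r K}` is the Minkowski functional
of `K`. -/
def supGauge {d : ℕ} (K S : Set (Fin d → ℂ)) : ℝ := sSup (gauge K '' S)

/-- `L_μ = max (1, sup_{x ∈ supp μ} max_i |x_i|)`; the norm of `Fin d → ℝ` is `max_i |x_i|`. -/
def supportRadius {d : ℕ} (μ : Measure (Fin d → ℝ)) : ℝ :=
  max 1 (sSup ((fun x : Fin d → ℝ => ‖x‖) '' μ.support))

/-- The empirical measure `N⁻¹ ∑ δ_{x^i}` of the first `N` terms of a sequence. -/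
def empiricalMeasure {d : ℕ} (x : ℕ → Fin d → ℝ) (N : ℕ) : Measure (Fin d → ℝ) :=
  (N : ℝ≥0∞)⁻¹ • ∑ i ∈ Finset.range N, Measure.dirac (x i)

/-- Weak convergence of measures, tested on bounded continuous functions. -/
def WeaklyConverges {d : ℕ} (ν : ℕ → Measure (Fin d → ℝ)) (μ : Measure (Fin d → ℝ)) : Prop :=
  ∀ h : BoundedContinuousFunction (Fin d → ℝ) ℝ,
    Tendsto (fun N => ∫ x, h x ∂(ν N)) atTop (𝓝 (∫ x, h x ∂μ))

/-- The sum of squares `∑_i |P(x^i) - g(x^i)|²`. -/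
def residual {d N : ℕ} (x : Fin N → Fin d → ℝ) (g : (Fin d → ℂ) → ℂ)
    (P : MvPolynomial (Fin d) ℂ) : ℝ :=
  ∑ i, ‖MvPolynomial.eval (toComplex (x i)) P - g (toComplex (x i))‖ ^ 2

/-- `P` is a least-squares polynomial of degree (at most) `n` for the data `(x^i, g(x^i))`. -/
def IsLeastSquares {d N : ℕ} (n : ℕ) (x : Fin N → Fin d → ℝ) (g : (Fin d → ℂ) → ℂ)
    (P : MvPolynomial (Fin d) ℂ) : Prop :=
  P.totalDegree ≤ n ∧
    ∀ Q : MvPolynomial (Fin d) ℂ, Q.totalDegree ≤ n → residual x g P ≤ residual x g Q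

/-- The truncation `∑_{|α| ≤ m} c_α x^α` of the polynomial `P = ∑_α c_α x^α`. -/
def truncation {d : ℕ} (m : ℕ) (P : MvPolynomial (Fin d) ℂ) : MvPolynomial (Fin d) ℂ :=
  ∑ k ∈ Finset.range (m + 1), MvPolynomial.homogeneousComponent k P

/-- `sup_{z ∈ K₁} |P(z) - g(z)|`, with values in `[0, ∞]`. -/
def uniformError {d : ℕ} (K₁ : Set (Fin d → ℂ)) (P : MvPolynomial (Fin d) ℂ)
    (g : (Fin d → ℂ) → ℂ) : ℝ≥0∞ :=
  ⨆ z ∈ K₁, ‖MvPolynomial.eval z P - g z‖ₑ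

end LSApprox

end

/-! The Taylor polynomials of `g` at `0` serve as competitors in the least-squares problem. Since
`g` is analytic on `ρ K₀` for some `ρ > 1`, Cauchy estimates on complex lines through `0` make the
error of the degree-`m` Taylor polynomial `T m` at `z ∈ K₀` at most a constant times the `m`-th
power of the gauge of `z` (`exists_taylorPolynomial`). Truncating `T n` at degree `m` gives `T m`,
so the truncated fit `P` differs from `g` by the truncation of `P - T n` plus an error of order
`R_{K₁}^m`.

To bound the truncation of `P - T n`, let `κ` be a lower bound for the quadratic form of the
empirical moment matrix. Minimality of `P` bounds the mean square of `P - T n` at the samples by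
four times that of `T n - g`. Division by `κ` then controls the `ℓ²` norm of the coefficients. By
Cauchy–Schwarz this controls the values of the truncation, because `∑_{|α| ≤ m} |z^α|² ≤ m! exp(∑
|z_i|²)` (`norm_eval_truncation_sub_le`). The factor `√(m!)` comes from there.

It remains to choose `κ`. The Hilbert–Schmidt distance from the empirical to the exact moment matrix
bounds the loss in the smallest eigenvalue (`mul_sum_sq_le_sum_sq_div`), and that eigenvalue is
positive because zero sets of nonzero polynomials are null. Under weak convergence the distance
tends to `0`, so `κ` tends to `Λ_n(μ)`. For independent samples a Hilbert-space bounded differences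
inequality (`measure_pi_norm_sum_ge_le`) keeps the distance below `7/8 Λ_n(μ)`, so `κ = Λ_n(μ) / 8`
works; the lost factor goes into the final constant. -/

namespace LSApprox

/-! ### Coefficients, truncations and zero sets of polynomials -/

section Polynomials

variable {d n : ℕ}

/-- The exponent vector of a multi-index, as a finitely supported function. -/
noncomputable def MultiIndex.exponent (α : MultiIndex d n) : Fin d →₀ ℕ :=
  Finsupp.equivFunOnFinite.symm fun i => (α.1 i : ℕ)

/-- The value `x ^ α` of a monomial. -/
def monomialValue {R : Type*} [CommMonoid R] (x : Fin d → R) (α : MultiIndex d n) : R :=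
  ∏ i, x i ^ (α.1 i : ℕ)

theorem MultiIndex.exponent_injective :
    Function.Injective (MultiIndex.exponent : MultiIndex d n → Fin d →₀ ℕ) := by
  intro α β h
  ext i
  exact DFunLike.congr_fun h i

theorem MultiIndex.degree_exponent (α : MultiIndex d n) :
    α.exponent.degree = ∑ i, (α.1 i : ℕ) := by
  rw [Finsupp.degree_eq_sum]; rfl

theorem MultiIndex.exists_exponent_eq {s : Fin d →₀ ℕ} (hs : s.degree ≤ n) :
    ∃ α : MultiIndex d n, α.exponent = s := by
  rw [Finsupp.degree_eq_sum] at hs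
  refine ⟨⟨fun i => ⟨s i, Nat.lt_succ_of_le
    ((Finset.single_le_sum (f := fun i => s i) (fun _ _ => Nat.zero_le _)
      (Finset.mem_univ i)).trans hs)⟩, hs⟩, ?_⟩
  ext i
  rfl

theorem eval_eq_sum_multiIndex {R : Type*} [CommSemiring R] {Q : MvPolynomial (Fin d) R}
    (hQ : Q.totalDegree ≤ n) (z : Fin d → R) :
    MvPolynomial.eval z Q
      = ∑ α : MultiIndex d n, MvPolynomial.coeff α.exponent Q * monomialValue z α := by
  classical
  rw [MvPolynomial.eval_eq']
  have h : ∑ α : MultiIndex d n, MvPolynomial.coeff α.exponent Q * monomialValue z α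
      = ∑ s ∈ (Finset.univ : Finset (MultiIndex d n)).map
          ⟨MultiIndex.exponent, MultiIndex.exponent_injective⟩,
        MvPolynomial.coeff s Q * ∏ i, z i ^ s i := by
    rw [Finset.sum_map]; rfl
  rw [h]
  refine Finset.sum_subset (fun s hs => ?_) fun s _ hs => ?_
  · obtain ⟨α, hα⟩ := MultiIndex.exists_exponent_eq (n := n)
      ((MvPolynomial.le_totalDegree hs).trans hQ)
    exact Finset.mem_map.2 ⟨α, Finset.mem_univ _, hα⟩
  · rw [MvPolynomial.notMem_support_iff.1 hs, zero_mul]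

theorem coeff_truncation (m : ℕ) (P : MvPolynomial (Fin d) ℂ) (s : Fin d →₀ ℕ) :
    MvPolynomial.coeff s (truncation m P)
      = if s.degree ≤ m then MvPolynomial.coeff s P else 0 := by
  simp [truncation, MvPolynomial.coeff_sum, MvPolynomial.coeff_homogeneousComponent]

theorem truncation_sub (m : ℕ) (P Q : MvPolynomial (Fin d) ℂ) :
    truncation m (P - Q) = truncation m P - truncation m Q := by
  simp [truncation, Finset.sum_sub_distrib]

theorem totalDegree_truncation_le (m : ℕ) (P : MvPolynomial (Fin d) ℂ) :
    (truncation m P).totalDegree ≤ P.totalDegree := by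
  refine MvPolynomial.totalDegree_le_of_support_subset fun s hs => ?_
  rw [MvPolynomial.mem_support_iff, coeff_truncation] at hs
  rw [MvPolynomial.mem_support_iff]
  split_ifs at hs
  · exact hs
  · exact absurd rfl hs

theorem sq_norm_monomialValue_le {m : ℕ} (z : Fin d → ℂ) (α : MultiIndex d n)
    (hα : ∑ i, (α.1 i : ℕ) ≤ m) :
    ‖monomialValue z α‖ ^ 2
      ≤ m.factorial * ∏ i, (‖z i‖ ^ 2) ^ (α.1 i : ℕ) / ((α.1 i : ℕ).factorial : ℝ) := by
  have h1 : ∏ i, (α.1 i : ℕ).factorial ≤ m.factorial :=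
    (Nat.le_of_dvd (Nat.factorial_pos _) (Nat.prod_factorial_dvd_factorial_sum _ _)).trans
      (Nat.factorial_le hα)
  have h2 : (0 : ℝ) < ∏ i, ((α.1 i : ℕ).factorial : ℝ) :=
    Finset.prod_pos fun i _ => by exact_mod_cast Nat.factorial_pos _
  rw [Finset.prod_div_distrib, mul_div_assoc', le_div_iff₀ h2, mul_comm]
  have h3 : ‖monomialValue z α‖ ^ 2 = ∏ i, (‖z i‖ ^ 2) ^ (α.1 i : ℕ) := by
    simp only [monomialValue, norm_prod, norm_pow, ← Finset.prod_pow]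
    exact Finset.prod_congr rfl fun i _ => by ring
  rw [h3]
  refine mul_le_mul_of_nonneg_right ?_ (Finset.prod_nonneg fun i _ => by positivity)
  exact_mod_cast h1

/-- Since `α! ≤ m!`, each term is at most `m!` times `∏ |z_i|^(2α_i) / α_i!`. Enlarging the simplex
of multi-indices to the box `{0,…,n}^d` makes the sum factor into partial sums of exponential
series, so the bound does not depend on `n`. -/
theorem sum_sq_norm_monomialValue_le (m : ℕ) (z : Fin d → ℂ) :
    ∑ α : MultiIndex d n, ‖if ∑ i, (α.1 i : ℕ) ≤ m then monomialValue z α else 0‖ ^ 2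
      ≤ m.factorial * Real.exp (∑ i, ‖z i‖ ^ 2) := by
  set w : (Fin d → Fin (n + 1)) → ℝ := fun α =>
    ∏ i, (‖z i‖ ^ 2) ^ (α i : ℕ) / ((α i : ℕ).factorial : ℝ) with hw
  have hw0 : ∀ α, 0 ≤ w α := fun α => Finset.prod_nonneg fun i _ => by positivity
  calc _ ≤ ∑ α : MultiIndex d n, m.factorial * w α.1 := by
        refine Finset.sum_le_sum fun α _ => ?_
        split_ifs with h
        · exact sq_norm_monomialValue_le z α h
        · simpa using mul_nonneg (Nat.cast_nonneg _) (hw0 _)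
    _ = m.factorial * ∑ α : MultiIndex d n, w α.1 := by rw [Finset.mul_sum]
    _ ≤ m.factorial * ∑ α, w α := by
        refine mul_le_mul_of_nonneg_left ?_ (Nat.cast_nonneg _)
        rw [← Finset.sum_subtype (Finset.univ.filter fun α : Fin d → Fin (n + 1) =>
          ∑ i, (α i : ℕ) ≤ n) (fun α => by simp) w]
        exact Finset.sum_le_sum_of_subset_of_nonneg (Finset.filter_subset _ _)
          fun α _ _ => hw0 α
    _ = m.factorial * ∏ i, ∑ j : Fin (n + 1), (‖z i‖ ^ 2) ^ (j : ℕ) / ((j : ℕ).factorial : ℝ) := by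
        rw [Finset.prod_univ_sum, Fintype.piFinset_univ]
    _ ≤ _ := by
        rw [Real.exp_sum]
        refine mul_le_mul_of_nonneg_left (Finset.prod_le_prod
          (fun i _ => Finset.sum_nonneg fun j _ => by positivity) fun i _ => ?_)
          (Nat.cast_nonneg _)
        rw [Fin.sum_univ_eq_sum_range (fun j => (‖z i‖ ^ 2) ^ j / (j.factorial : ℝ))]
        exact Real.sum_le_exp_of_nonneg (sq_nonneg _) _

theorem sq_norm_eval_truncation_le (m : ℕ) {Q : MvPolynomial (Fin d) ℂ}
    (hQ : Q.totalDegree ≤ n) (z : Fin d → ℂ) :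
    ‖MvPolynomial.eval z (truncation m Q)‖ ^ 2
      ≤ (∑ α : MultiIndex d n, ‖MvPolynomial.coeff α.exponent Q‖ ^ 2) *
        (m.factorial * Real.exp (∑ i, ‖z i‖ ^ 2)) := by
  have h : ‖MvPolynomial.eval z (truncation m Q)‖ ≤ ∑ α : MultiIndex d n,
      ‖MvPolynomial.coeff α.exponent Q‖ *
        ‖if ∑ i, (α.1 i : ℕ) ≤ m then monomialValue z α else 0‖ := by
    rw [eval_eq_sum_multiIndex ((totalDegree_truncation_le m Q).trans hQ)]
    refine (norm_sum_le _ _).trans (Finset.sum_le_sum fun α _ => ?_)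
    rw [coeff_truncation, MultiIndex.degree_exponent, norm_mul]
    split_ifs <;> simp
  calc _ ≤ _ := pow_le_pow_left₀ (norm_nonneg _) h 2
    _ ≤ _ := Finset.sum_mul_sq_le_sq_mul_sq _ _ _
    _ ≤ _ := mul_le_mul_of_nonneg_left (sum_sq_norm_monomialValue_le m z)
        (Finset.sum_nonneg fun _ _ => sq_nonneg _)

/-- The factor `4` comes from `(a + b)² ≤ 2a² + 2b²` followed by minimality of `P` against the
competitor `T`. -/
theorem sum_sq_norm_eval_sub_le {N : ℕ} {x : Fin N → Fin d → ℝ} {g : (Fin d → ℂ) → ℂ}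
    {P T : MvPolynomial (Fin d) ℂ} (hP : IsLeastSquares n x g P) (hT : T.totalDegree ≤ n) :
    ∑ i, ‖MvPolynomial.eval (toComplex (x i)) (P - T)‖ ^ 2 ≤ 4 * residual x g T := by
  have h1 := hP.2 T hT
  have h2 : ∑ i, ‖MvPolynomial.eval (toComplex (x i)) (P - T)‖ ^ 2
      ≤ 2 * residual x g P + 2 * residual x g T := by
    simp only [residual, Finset.mul_sum, ← Finset.sum_add_distrib]
    refine Finset.sum_le_sum fun i _ => ?_
    have h := norm_sub_le
      (MvPolynomial.eval (toComplex (x i)) P - g (toComplex (x i)))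
      (MvPolynomial.eval (toComplex (x i)) T - g (toComplex (x i)))
    rw [sub_sub_sub_cancel_right, ← map_sub] at h
    nlinarith [norm_nonneg (MvPolynomial.eval (toComplex (x i)) (P - T)),
      sq_nonneg (‖MvPolynomial.eval (toComplex (x i)) P - g (toComplex (x i))‖
        - ‖MvPolynomial.eval (toComplex (x i)) T - g (toComplex (x i))‖)]
  linarith

/-- The zero set of a nonzero real polynomial is Lebesgue null. -/
theorem volume_zeros_mvPolynomial {d : ℕ} {p : MvPolynomial (Fin d) ℝ} (hp : p ≠ 0) :
    volume {x : Fin d → ℝ | MvPolynomial.eval x p = 0} = 0 := by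
  induction d with
  | zero =>
    have : {x : Fin 0 → ℝ | MvPolynomial.eval x p = 0} = ∅ := by
      ext x
      rw [MvPolynomial.eq_C_of_isEmpty p] at hp ⊢
      simpa using hp
    rw [this, measure_empty]
  | succ d ih =>
    set q := MvPolynomial.finSuccEquiv ℝ d p with hq
    have hq0 : q ≠ 0 := by simpa [hq] using hp
    -- View `p` as a polynomial in the first variable. Its leading coefficient vanishes only on a
    -- null set of the others, and off that set the slice has finitely many roots; Fubini concludes.
    have hlead := ih (Polynomial.leadingCoeff_ne_zero.2 hq0)
    have hmeas : MeasurableSet {x : Fin (d + 1) → ℝ | MvPolynomial.eval x p = 0} :=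
      (MvPolynomial.continuous_eval p).measurable (measurableSet_singleton 0)
    have hmp := (volume_preserving_piFinSuccAbove (fun _ : Fin (d + 1) => ℝ) 0).symm
    rw [← hmp.measure_preimage hmeas.nullMeasurableSet]
    -- The factors are swapped so that the slices are taken in the distinguished variable, over the
    -- remaining `d`.
    have hsw := (Measure.measurePreserving_swap (μ := (volume : Measure (Fin d → ℝ)))
      (ν := (volume : Measure ℝ)))
    rw [Measure.volume_eq_prod]
    have hmeas' := (MeasurableEquiv.measurable
      (MeasurableEquiv.piFinSuccAbove (fun _ : Fin (d + 1) => ℝ) 0).symm) hmeas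
    rw [← hsw.measure_preimage hmeas'.nullMeasurableSet]
    refine Measure.measure_prod_null_of_ae_null (hsw.measurable hmeas') ?_
    have hae : ∀ᵐ y : Fin d → ℝ, MvPolynomial.eval y q.leadingCoeff ≠ 0 := by
      rw [ae_iff]; simpa using hlead
    filter_upwards [hae] with y hy
    have hr : q.map (MvPolynomial.eval y) ≠ 0 := fun h => hy (by
      have := congrArg (fun r => Polynomial.coeff r q.natDegree) h
      simpa using this)
    refine Set.Finite.measure_zero
      (((q.map (MvPolynomial.eval y)).roots.toFinset.finite_toSet).subset fun t ht => ?_) _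
    simp only [Set.mem_preimage, Prod.swap_prod_mk, Set.mem_ofPred_eq,
      MeasurableEquiv.piFinSuccAbove] at ht
    simp only [Finset.mem_coe, Multiset.mem_toFinset, Polynomial.mem_roots hr,
      Polynomial.IsRoot.def]
    rw [hq, ← MvPolynomial.eval_eq_eval_mv_eval']
    simpa [Fin.insertNthEquiv] using ht

theorem volume_zeros_sum_monomialValue {c : MultiIndex d n → ℝ} (hc : c ≠ 0) :
    volume {x : Fin d → ℝ | ∑ α, c α * monomialValue x α = 0} = 0 := by
  classical
  set p : MvPolynomial (Fin d) ℝ := ∑ α, MvPolynomial.monomial (MultiIndex.exponent α) (c α)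
  have hcoeff : ∀ α : MultiIndex d n, MvPolynomial.coeff α.exponent p = c α := fun α => by
    simp only [p, MvPolynomial.coeff_sum, MvPolynomial.coeff_monomial,
      MultiIndex.exponent_injective.eq_iff]
    simp
  have hp : p ≠ 0 := fun h => hc (funext fun α => by rw [← hcoeff, h]; simp)
  have heval : ∀ x : Fin d → ℝ, MvPolynomial.eval x p = ∑ α, c α * monomialValue x α := by
    intro x
    simp only [p, map_sum, MvPolynomial.eval_monomial]
    refine Finset.sum_congr rfl fun α _ => ?_
    rw [Finsupp.prod_fintype _ _ (fun i => pow_zero _)]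
    rfl
  simpa only [heval] using volume_zeros_mvPolynomial hp

end Polynomials

/-! ### Taylor polynomials on an absolutely convex compact set -/

section Taylor

variable {d : ℕ}

theorem IsAbsConvex.smul_mem {K : Set (Fin d → ℂ)} (hK : IsAbsConvex K) {z : Fin d → ℂ}
    (hz : z ∈ K) {a : ℂ} (ha : ‖a‖ ≤ 1) : a • z ∈ K := by
  simpa using hK z hz z hz a 0 (by simpa using ha)

/-- The diagonal of a multilinear form on `ℂ^d`, as a polynomial. -/
noncomputable def diagonalPolynomial {k : ℕ}
    (p : ContinuousMultilinearMap ℂ (fun _ : Fin k => Fin d → ℂ) ℂ) : MvPolynomial (Fin d) ℂ :=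
  ∑ f : Fin k → Fin d, MvPolynomial.C (p fun j => Pi.single (f j) 1) *
    ∏ j, MvPolynomial.X (f j)

theorem isHomogeneous_diagonalPolynomial {k : ℕ}
    (p : ContinuousMultilinearMap ℂ (fun _ : Fin k => Fin d → ℂ) ℂ) :
    (diagonalPolynomial p).IsHomogeneous k := by
  refine MvPolynomial.IsHomogeneous.sum _ _ _ fun f _ => ?_
  have h := (MvPolynomial.isHomogeneous_C (Fin d) (p fun j => Pi.single (f j) 1)).mul
    (MvPolynomial.IsHomogeneous.prod Finset.univ (fun j => MvPolynomial.X (R := ℂ) (f j))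
      (fun _ => 1) fun j _ => MvPolynomial.isHomogeneous_X ℂ (f j))
  simpa using h

theorem eval_diagonalPolynomial {k : ℕ}
    (p : ContinuousMultilinearMap ℂ (fun _ : Fin k => Fin d → ℂ) ℂ) (z : Fin d → ℂ) :
    MvPolynomial.eval z (diagonalPolynomial p) = p fun _ => z := by
  have hz : z = ∑ i, z i • (Pi.single i 1 : Fin d → ℂ) := by
    ext j; simp [Finset.sum_apply, Pi.single_apply]
  have h : (p fun _ => z) = p fun _ => ∑ i, z i • (Pi.single i 1 : Fin d → ℂ) := by
    rw [← hz]
  rw [h, ContinuousMultilinearMap.map_sum]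
  simp only [diagonalPolynomial, map_sum, map_mul, MvPolynomial.eval_C, map_prod,
    MvPolynomial.eval_X, ContinuousMultilinearMap.map_smul_univ, smul_eq_mul, mul_comm]

theorem homogeneousComponent_sum_diagonalPolynomial
    (p : FormalMultilinearSeries ℂ (Fin d → ℂ) ℂ) {n k : ℕ} (hk : k ≤ n) :
    MvPolynomial.homogeneousComponent k
      (∑ j ∈ Finset.range (n + 1), diagonalPolynomial (p j)) = diagonalPolynomial (p k) := by
  rw [map_sum, Finset.sum_eq_single k]
  · exact MvPolynomial.homogeneousComponent_eq_self (isHomogeneous_diagonalPolynomial _)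
  · intro j _ hj
    rw [MvPolynomial.homogeneousComponent_of_mem
      ((MvPolynomial.mem_homogeneousSubmodule _ _).2 (isHomogeneous_diagonalPolynomial (p j))),
      if_neg hj.symm]
  · intro h
    exact absurd (Finset.mem_range.2 (Nat.lt_succ_of_le hk)) h

theorem exists_smul_analyticAt {K : Set (Fin d → ℂ)} (hK : IsCompact K)
    {g : (Fin d → ℂ) → ℂ} (hg : AnalyticOnNhd ℂ g K) :
    ∃ ρ : ℝ, 1 < ρ ∧ ∀ z ∈ K, AnalyticAt ℂ g ((ρ : ℂ) • z) := by
  have h : ∀ᶠ ρ : ℝ in 𝓝 1, ∀ z ∈ K, AnalyticAt ℂ g ((ρ : ℂ) • z) := by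
    refine hK.eventually_forall_of_forall_eventually fun z hz => ?_
    have hc : ContinuousAt (fun q : ℝ × (Fin d → ℂ) => (q.1 : ℂ) • q.2) (1, z) := by fun_prop
    have hopen := (isOpen_analyticAt ℂ g).mem_nhds (x := ((1 : ℝ) : ℂ) • z)
      (by simpa using hg z hz)
    exact hc hopen
  obtain ⟨ρ, h1, h2⟩ := ((h.filter_mono nhdsWithin_le_nhds).and
    (self_mem_nhdsWithin : Set.Ioi (1 : ℝ) ∈ 𝓝[>] 1)).exists
  exact ⟨ρ, h2, h1⟩

/-- For `z ∈ K` the line `ζ ↦ ζ z` maps the closed disc of radius `ρ` into `ρ K`, where `g` is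
analytic and bounded. Uniqueness of one-variable power series identifies the Cauchy coefficients of
`ζ ↦ g (ζ z)` with `p k (z,…,z)`; evaluation at `ζ = 1 < ρ` gives convergence on all of `K`, and
Cauchy estimates give decay uniform in `z`. -/
theorem hasSum_of_analyticOnNhd {K : Set (Fin d → ℂ)} (hK : IsCompact K)
    (hKc : IsAbsConvex K) {g : (Fin d → ℂ) → ℂ}
    (hg : AnalyticOnNhd ℂ g K) {p : FormalMultilinearSeries ℂ (Fin d → ℂ) ℂ}
    (hp : HasFPowerSeriesAt g p 0) :
    ∃ ρ B : ℝ, 1 < ρ ∧ 0 ≤ B ∧ ∀ z ∈ K, HasSum (fun k => p k fun _ => z) (g z) ∧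
      ∀ k, ‖p k fun _ => z‖ ≤ B * ρ⁻¹ ^ k := by
  obtain ⟨ρ, hρ, han⟩ := exists_smul_analyticAt hK hg
  have hρ0 : 0 < ρ := one_pos.trans hρ
  have hρc : (ρ : ℂ) ≠ 0 := by exact_mod_cast hρ0.ne'
  obtain ⟨B, hB⟩ := hK.exists_bound_of_continuousOn (f := fun z => g ((ρ : ℂ) • z))
    fun z hz => ((han z hz).continuousAt.comp (f := fun z => (ρ : ℂ) • z)
      (by fun_prop)).continuousWithinAt
  refine ⟨ρ, max B 0, hρ, le_max_right _ _, fun z hz => ?_⟩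
  have hmem : ∀ ζ : ℂ, ‖ζ‖ ≤ ρ → ∃ w ∈ K, ζ • z = (ρ : ℂ) • w := fun ζ hζ => by
    refine ⟨(ζ / ρ) • z, hKc.smul_mem hz ?_, ?_⟩
    · rw [norm_div, Complex.norm_real, Real.norm_of_nonneg hρ0.le]
      exact (div_le_one hρ0).2 hζ
    · rw [smul_smul, mul_div_cancel₀ _ hρc]
  set u : ℂ →L[ℂ] (Fin d → ℂ) := ContinuousLinearMap.toSpanSingleton ℂ z with hu
  lift ρ to NNReal using hρ0.le
  have hdiff : DifferentiableOn ℂ (g ∘ u) (Metric.closedBall 0 ρ) := fun ζ hζ => by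
    obtain ⟨w, hw, h⟩ := hmem ζ (by simpa using hζ)
    have hd : DifferentiableAt ℂ g (u ζ) := by
      have := (han w hw).differentiableAt
      rwa [← h] at this
    exact (hd.comp ζ u.differentiableAt).differentiableWithinAt
  have hcauchy := hdiff.hasFPowerSeriesOnBall (by exact_mod_cast hρ0)
  have hcomp : HasFPowerSeriesAt (g ∘ u) (p.compContinuousLinearMap u) 0 :=
    HasFPowerSeriesAt.compContinuousLinearMap (by simpa using hp)
  have heq := hcauchy.hasFPowerSeriesAt.eq_formalMultilinearSeries hcomp
  have hterm : ∀ k, (cauchyPowerSeries (g ∘ u) 0 ρ k fun _ => (1 : ℂ)) = p k fun _ => z := by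
    intro k
    rw [heq]
    simp only [FormalMultilinearSeries.compContinuousLinearMap_apply]
    congr 1
    ext i
    simp [hu]
  refine ⟨?_, fun k => ?_⟩
  · have h1 : (1 : ℂ) ∈ Metric.eball (0 : ℂ) ρ := by
      rw [Metric.eball_coe]
      simpa using hρ
    have := hcauchy.hasSum h1
    simp only [hterm] at this
    simpa [hu] using this
  · rw [← hterm]
    refine (ContinuousMultilinearMap.le_opNorm _ _).trans ?_
    simp only [norm_one, Finset.prod_const_one, mul_one]
    refine (norm_cauchyPowerSeries_le _ _ _ _).trans ?_
    rw [abs_of_pos hρ0]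
    refine mul_le_mul_of_nonneg_right ?_ (by positivity)
    have hint : ∫ θ : ℝ in 0..2 * Real.pi, ‖(g ∘ u) (circleMap 0 ρ θ)‖
        ≤ max B 0 * (2 * Real.pi) := by
      have h := intervalIntegral.norm_integral_le_of_norm_le_const (a := 0) (b := 2 * Real.pi)
        (C := max B 0) (f := fun θ : ℝ => ‖(g ∘ u) (circleMap 0 ρ θ)‖) fun θ _ => by
          obtain ⟨w, hw, h⟩ := hmem (circleMap 0 ρ θ) (by simp)
          rw [norm_norm]
          change ‖g (circleMap 0 ρ θ • z)‖ ≤ _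
          rw [h]
          exact (hB w hw).trans (le_max_left _ _)
      rw [sub_zero, abs_of_pos Real.two_pi_pos] at h
      exact (le_abs_self _).trans h
    calc _ ≤ (2 * Real.pi)⁻¹ * (max B 0 * (2 * Real.pi)) :=
          mul_le_mul_of_nonneg_left hint (by positivity)
      _ = max B 0 := by field_simp

/-- Homogeneity of degree `k`: for every `r` above the gauge, `z = b w` with `w ∈ K` and `0 < b <
r`. Then `r` decreases to the gauge. -/
theorem norm_le_mul_gauge_pow {K : Set (Fin d → ℂ)} (hK : Absorbent ℝ K) {k : ℕ}
    (p : ContinuousMultilinearMap ℂ (fun _ : Fin k => Fin d → ℂ) ℂ) {C : ℝ}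
    (hp : ∀ z ∈ K, ‖p fun _ => z‖ ≤ C) (z : Fin d → ℂ) :
    ‖p fun _ => z‖ ≤ C * gauge K z ^ k := by
  have hlim : Tendsto (fun r : ℝ => C * r ^ k) (𝓝[>] gauge K z) (𝓝 (C * gauge K z ^ k)) :=
    (Continuous.tendsto (by fun_prop) _).mono_left nhdsWithin_le_nhds
  refine ge_of_tendsto hlim ?_
  filter_upwards [self_mem_nhdsWithin] with r hr
  obtain ⟨b, hb0, hbr, w, hw, hbw⟩ := exists_lt_of_gauge_lt hK hr
  have hz : z = (b : ℂ) • w := by rw [← hbw]; ext i; simp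
  have h : (p fun _ => z) = (b : ℂ) ^ k * p fun _ => w := by
    rw [hz, ContinuousMultilinearMap.map_smul_univ p (fun _ => (b : ℂ)) fun _ => w]
    simp
  rw [h, norm_mul, norm_pow, Complex.norm_real, Real.norm_of_nonneg hb0.le, mul_comm]
  exact mul_le_mul (hp w hw) (pow_le_pow_left₀ hb0.le hbr.le k) (by positivity)
    ((norm_nonneg _).trans (hp w hw))

/-- Taylor polynomials at the origin of a function analytic on an absolutely convex compact
neighbourhood of the origin. -/
theorem exists_taylorPolynomial {K : Set (Fin d → ℂ)} (hK : IsCompact K) (hK0 : K ∈ 𝓝 0)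
    (hKc : IsAbsConvex K) {g : (Fin d → ℂ) → ℂ} (hg : AnalyticOnNhd ℂ g K) :
    ∃ (T : ℕ → MvPolynomial (Fin d) ℂ) (M : ℝ), 0 ≤ M ∧ (∀ n, (T n).totalDegree ≤ n) ∧
      (∀ m n, m ≤ n → truncation m (T n) = T m) ∧
      ∀ m, ∀ z ∈ K, ‖MvPolynomial.eval z (T m) - g z‖ ≤ M * gauge K z ^ m := by
  obtain ⟨p, hp⟩ := hg 0 (mem_of_mem_nhds hK0)
  obtain ⟨ρ, B, hρ, hB, hsum⟩ := hasSum_of_analyticOnNhd hK hKc hg hp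
  have hρ0 : 0 < ρ := one_pos.trans hρ
  have hρ1 : ρ⁻¹ < 1 := inv_lt_one_of_one_lt₀ hρ
  have hρi : 0 < ρ⁻¹ := inv_pos.2 hρ0
  refine ⟨fun n => ∑ k ∈ Finset.range (n + 1), diagonalPolynomial (p k), B * (1 - ρ⁻¹)⁻¹,
    mul_nonneg hB (inv_nonneg.2 (sub_nonneg.2 hρ1.le)), fun n => ?_, fun m n hmn => ?_,
    fun m z hz => ?_⟩
  · refine MvPolynomial.totalDegree_finsetSum_le fun k hk => ?_
    exact (isHomogeneous_diagonalPolynomial _).totalDegree_le.trans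
      (Nat.lt_succ_iff.1 (Finset.mem_range.1 hk))
  · refine Finset.sum_congr rfl fun k hk => ?_
    exact homogeneousComponent_sum_diagonalPolynomial p
      ((Nat.lt_succ_iff.1 (Finset.mem_range.1 hk)).trans hmn)
  · set γ := gauge K z with hγ
    have hγ0 : 0 ≤ γ := gauge_nonneg z
    have hγ1 : γ ≤ 1 := gauge_le_one_of_mem hz
    have hbound : ∀ k, ‖p k fun _ => z‖ ≤ B * ρ⁻¹ ^ k * γ ^ k := fun k =>
      norm_le_mul_gauge_pow (absorbent_nhds_zero hK0) (p k) (fun w hw => (hsum w hw).2 k) z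
    have hshift := (hasSum_nat_add_iff' (m + 1)).2 (hsum z hz).1
    have hgeom := (hasSum_geometric_of_lt_one hρi.le hρ1).mul_left (B * γ ^ m)
    -- The Taylor tail is dominated by a geometric series: the gauge power supplies the common
    -- factor `γ ^ m`, and `ρ⁻¹ ^ k` supplies summability even when `γ = 1`.
    have h := hshift.norm_le_of_bounded hgeom fun k => by
      refine (hbound _).trans ?_
      have e1 : γ ^ (k + (m + 1)) ≤ γ ^ m := pow_le_pow_of_le_one hγ0 hγ1 (by omega)
      have e2 : ρ⁻¹ ^ (k + (m + 1)) ≤ ρ⁻¹ ^ k := pow_le_pow_of_le_one hρi.le hρ1.le (by omega)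
      calc _ ≤ B * ρ⁻¹ ^ k * γ ^ m := by gcongr
        _ = _ := by ring
    rw [norm_sub_rev, map_sum]
    simp only [eval_diagonalPolynomial]
    exact h.trans (le_of_eq (by ring))

end Taylor

/-! ### Concentration for sums of independent Hilbert-space vectors -/

section Concentration

theorem exists_mem_Icc_of_abs_sub_le {α : Type*} {T : Set α} (hT : T.Nonempty) {f : α → ℝ} {c : ℝ}
    (h : ∀ a ∈ T, ∀ b ∈ T, |f a - f b| ≤ c) : ∃ m, ∀ a ∈ T, f a ∈ Set.Icc m (m + c) := by
  obtain ⟨a₀, h₀⟩ := hT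
  have hbdd : BddBelow (f '' T) := ⟨f a₀ - c, by
    rintro _ ⟨b, hb, rfl⟩
    linarith [(abs_le.1 (h a₀ h₀ b hb)).2]⟩
  refine ⟨sInf (f '' T), fun a ha => ⟨csInf_le hbdd ⟨a, ha, rfl⟩, ?_⟩⟩
  have : f a - c ≤ sInf (f '' T) := by
    refine le_csInf ⟨_, a₀, h₀, rfl⟩ ?_
    rintro _ ⟨b, hb, rfl⟩
    linarith [(abs_le.1 (h a ha b hb)).2]
  linarith

theorem sq_integral_le_integral_sq {α : Type*} [MeasurableSpace α] {μ : Measure α}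
    [IsProbabilityMeasure μ] {f : α → ℝ} (hf : Integrable f μ)
    (hf2 : Integrable (fun a => f a ^ 2) μ) :
    (∫ a, f a ∂μ) ^ 2 ≤ ∫ a, f a ^ 2 ∂μ := by
  have h : 0 ≤ ∫ a, (f a - ∫ b, f b ∂μ) ^ 2 ∂μ := integral_nonneg fun a => sq_nonneg _
  have h2 : ∫ a, (f a - ∫ b, f b ∂μ) ^ 2 ∂μ
      = ∫ a, f a ^ 2 ∂μ - (∫ b, f b ∂μ) ^ 2 := by
    set m := ∫ b, f b ∂μ
    have : (fun a => (f a - m) ^ 2) = fun a => f a ^ 2 - (2 * m * f a - m ^ 2) := by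
      ext a; ring
    have hi : Integrable (fun a => 2 * m * f a - m ^ 2) μ :=
      (hf.const_mul _).sub (integrable_const _)
    rw [this, integral_sub hf2 hi, integral_sub (hf.const_mul _) (integrable_const _),
      integral_const_mul]
    simp only [integral_const, probReal_univ, one_smul]
    ring
  linarith

variable {α E : Type*} [MeasurableSpace α] [NormedAddCommGroup E]

/-- The expected norm of `s + ∑_{i < k} Y_i` for independent copies `Y_i` of `Y`. -/
noncomputable def meanNorm (μ : Measure α) (Y : α → E) : ℕ → E → ℝ
  | 0, s => ‖s‖
  | k + 1, s => ∫ a, meanNorm μ Y k (s + Y a) ∂μ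

theorem integrable_lipschitz_comp_add {μ : Measure α} [IsProbabilityMeasure μ] {Y : α → E}
    (hY : Integrable Y μ) {f : E → ℝ} (hf : LipschitzWith 1 f) (s : E) :
    Integrable (fun a => f (s + Y a)) μ := by
  refine Integrable.mono' (g := fun a => |f s| + ‖Y a‖) ((integrable_const _).add hY.norm)
    (hf.continuous.comp_aestronglyMeasurable (hY.aestronglyMeasurable.const_add s)) ?_
  filter_upwards with a
  have h := hf.dist_le_mul (s + Y a) s
  simp only [Real.dist_eq, NNReal.coe_one, one_mul, dist_self_add_left] at h
  rw [Real.norm_eq_abs]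
  have := abs_sub_abs_le_abs_sub (f (s + Y a)) (f s)
  linarith

/-- Averaging preserves the Lipschitz constant of the norm. Hence revealing one more summand moves
the conditional mean by at most the oscillation of `Y`. -/
theorem lipschitzWith_meanNorm {μ : Measure α} [IsProbabilityMeasure μ] {Y : α → E}
    (hY : Integrable Y μ) (k : ℕ) : LipschitzWith 1 (meanNorm μ Y k) := by
  induction k with
  | zero => exact lipschitzWith_one_norm
  | succ k ih =>
    refine LipschitzWith.of_dist_le_mul fun s t => ?_
    simp only [meanNorm, Real.dist_eq, NNReal.coe_one, one_mul]
    rw [← integral_sub (integrable_lipschitz_comp_add hY ih s)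
      (integrable_lipschitz_comp_add hY ih t)]
    have h : ‖∫ a, (meanNorm μ Y k (s + Y a) - meanNorm μ Y k (t + Y a)) ∂μ‖
        ≤ dist s t * μ.real Set.univ := by
      refine norm_integral_le_of_norm_le_const ?_
      filter_upwards with a
      simpa [Real.dist_eq] using ih.dist_le_mul (s + Y a) (t + Y a)
    simpa using h

/-- Jensen's inequality and additivity of variance: the cross term with the centred `Y` integrates
to zero at each stage. -/
theorem sq_meanNorm_le [InnerProductSpace ℝ E] [CompleteSpace E] {μ : Measure α}
    [IsProbabilityMeasure μ] {Y : α → E} (hY : Integrable Y μ)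
    (hY2 : Integrable (fun a => ‖Y a‖ ^ 2) μ) (hY0 : ∫ a, Y a ∂μ = 0)
    (k : ℕ) (s : E) :
    meanNorm μ Y k s ^ 2 ≤ ‖s‖ ^ 2 + k * ∫ a, ‖Y a‖ ^ 2 ∂μ := by
  induction k generalizing s with
  | zero => simp [meanNorm]
  | succ k ih =>
    have hL := lipschitzWith_meanNorm (μ := μ) hY k
    have hin : Integrable (fun a => inner ℝ s (Y a)) μ := hY.const_inner s
    have hsq : (fun a => ‖s + Y a‖ ^ 2)
        = fun a => ‖s‖ ^ 2 + 2 * inner ℝ s (Y a) + ‖Y a‖ ^ 2 := by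
      ext a; exact norm_add_sq_real s (Y a)
    have hint : Integrable (fun a => ‖s + Y a‖ ^ 2) μ := by
      rw [hsq]; exact ((integrable_const _).add (hin.const_mul 2)).add hY2
    have hval : ∫ a, ‖s + Y a‖ ^ 2 ∂μ = ‖s‖ ^ 2 + ∫ a, ‖Y a‖ ^ 2 ∂μ := by
      have hi : Integrable (fun a => ‖s‖ ^ 2 + 2 * inner ℝ s (Y a)) μ :=
        (integrable_const _).add (hin.const_mul 2)
      rw [hsq, integral_add hi hY2,
        integral_add (integrable_const _) (hin.const_mul 2), integral_const_mul,
        integral_inner hY, hY0]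
      simp
    have hG : Integrable (fun a => meanNorm μ Y k (s + Y a)) μ :=
      integrable_lipschitz_comp_add hY hL s
    have hdom : Integrable (fun a => ‖s + Y a‖ ^ 2 + k * ∫ a, ‖Y a‖ ^ 2 ∂μ) μ :=
      hint.add (integrable_const _)
    have hG2 : Integrable (fun a => meanNorm μ Y k (s + Y a) ^ 2) μ := by
      refine hdom.mono' (hG.aestronglyMeasurable.pow 2) ?_
      filter_upwards with a
      rw [Real.norm_eq_abs, abs_of_nonneg (sq_nonneg _)]
      exact ih _
    calc meanNorm μ Y (k + 1) s ^ 2 ≤ ∫ a, meanNorm μ Y k (s + Y a) ^ 2 ∂μ :=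
          sq_integral_le_integral_sq hG hG2
      _ ≤ ∫ a, (‖s + Y a‖ ^ 2 + k * ∫ a, ‖Y a‖ ^ 2 ∂μ) ∂μ :=
          integral_mono hG2 hdom fun a => ih _
      _ = _ := by
          rw [integral_add hint (integrable_const _), hval]
          simp only [integral_const, probReal_univ, one_smul]
          push_cast; ring

variable [MeasurableSpace E] [BorelSpace E] [SecondCountableTopology E]

/-- The Doob martingale argument, written as a recursion: fix the first coordinate, apply induction
to the others, then apply Hoeffding's lemma to `a ↦ meanNorm μ Y k (s + Y a)`. This function
oscillates by at most `c` on `T` and has mean `meanNorm μ Y (k + 1) s`. -/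
theorem lintegral_exp_norm_sum_le {μ : Measure α} [IsProbabilityMeasure μ] {Y : α → E}
    (hYm : Measurable Y) (hY : Integrable Y μ) {T : Set α} (hT : ∀ᵐ a ∂μ, a ∈ T) {c : ℝ}
    (hc : ∀ a ∈ T, ∀ b ∈ T, ‖Y a - Y b‖ ≤ c) (t : ℝ) (k : ℕ) (s : E) :
    ∫⁻ x, ENNReal.ofReal (Real.exp (t * ‖s + ∑ i, Y (x i)‖)) ∂(Measure.pi fun _ : Fin k => μ)
      ≤ ENNReal.ofReal (Real.exp (t * meanNorm μ Y k s + k * (t ^ 2 * c ^ 2 / 8))) := by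
  induction k generalizing s with
  | zero => simp [meanNorm]
  | succ k ih =>
    have hTne : T.Nonempty := hT.exists.imp fun _ h => h
    have hL := lipschitzWith_meanNorm (μ := μ) hY k
    have hGm : Measurable fun a => meanNorm μ Y k (s + Y a) :=
      hL.continuous.measurable.comp (hYm.const_add s)
    obtain ⟨m, hm⟩ := exists_mem_Icc_of_abs_sub_le hTne (c := c)
      (f := fun a => meanNorm μ Y k (s + Y a)) (fun a ha b hb => by
        have := hL.dist_le_mul (s + Y a) (s + Y b)
        simp only [Real.dist_eq, NNReal.coe_one, one_mul, dist_add_left] at this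
        exact this.trans (by rw [dist_eq_norm]; exact hc a ha b hb))
    have hsub := hasSubgaussianMGF_of_mem_Icc (μ := μ) hGm.aemeasurable
      (hT.mono fun a ha => hm a ha)
    have hmeas : Measurable fun x : Fin (k + 1) → α =>
        ENNReal.ofReal (Real.exp (t * ‖s + ∑ i, Y (x i)‖)) := by
      have : Measurable fun x : Fin (k + 1) → α => ∑ i, Y (x i) :=
        Finset.measurable_sum _ fun i _ => hYm.comp (measurable_pi_apply i)
      exact (((this.const_add s).norm.const_mul t).exp).ennreal_ofReal
    have hmp := measurePreserving_piFinSuccAbove (fun _ : Fin (k + 1) => μ) 0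
    rw [← hmp.symm.lintegral_comp hmeas]
    refine (lintegral_prod (fun p : α × (Fin k → α) => ENNReal.ofReal (Real.exp (t *
      ‖s + ∑ i, Y ((MeasurableEquiv.piFinSuccAbove (fun _ => α) 0).symm p i)‖)))
      (hmeas.comp (MeasurableEquiv.measurable _)).aemeasurable).trans_le ?_
    set M := ∫ a, meanNorm μ Y k (s + Y a) ∂μ with hM
    calc _ ≤ ∫⁻ a, ENNReal.ofReal (Real.exp (t * meanNorm μ Y k (s + Y a)
              + k * (t ^ 2 * c ^ 2 / 8))) ∂μ := by
          refine lintegral_mono fun a => ?_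
          refine le_trans (le_of_eq ?_) (ih (s + Y a))
          refine lintegral_congr fun x => ?_
          simp [MeasurableEquiv.piFinSuccAbove, Fin.sum_univ_succ, add_assoc]
      _ = ENNReal.ofReal (Real.exp (t * M + k * (t ^ 2 * c ^ 2 / 8))) *
            ∫⁻ a, ENNReal.ofReal (Real.exp (t * (meanNorm μ Y k (s + Y a) - M))) ∂μ := by
          rw [← lintegral_const_mul _ (by fun_prop)]
          refine lintegral_congr fun a => ?_
          rw [← ENNReal.ofReal_mul (Real.exp_nonneg _), ← Real.exp_add]
          ring_nf
      _ ≤ ENNReal.ofReal (Real.exp (t * M + k * (t ^ 2 * c ^ 2 / 8))) *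
            ENNReal.ofReal (Real.exp (t ^ 2 * c ^ 2 / 8)) := by
          gcongr
          rw [← ofReal_integral_eq_lintegral_ofReal (hsub.integrable_exp_mul t)
            (ae_of_all _ fun _ => Real.exp_nonneg _)]
          refine ENNReal.ofReal_le_ofReal ((hsub.mgf_le t).trans (le_of_eq ?_))
          simp only [add_sub_cancel_left, NNReal.coe_pow, NNReal.coe_div, coe_nnnorm,
            Real.norm_eq_abs, NNReal.coe_ofNat, div_pow, sq_abs]
          ring_nf
      _ = _ := by
          rw [← ENNReal.ofReal_mul (Real.exp_nonneg _), ← Real.exp_add]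
          simp only [meanNorm]
          rw [← hM]
          push_cast
          ring_nf

/-- A bounded differences inequality for the norm of a sum of independent centred vectors. -/
theorem measure_pi_norm_sum_ge_le [InnerProductSpace ℝ E]
    [CompleteSpace E] {μ : Measure α} [IsProbabilityMeasure μ] {Y : α → E}
    (hYm : Measurable Y) (hY : Integrable Y μ) (hY2 : Integrable (fun a => ‖Y a‖ ^ 2) μ)
    (hY0 : ∫ a, Y a ∂μ = 0) {T : Set α} (hT : ∀ᵐ a ∂μ, a ∈ T) {R : ℝ} (hR : 0 < R)
    (hc : ∀ a ∈ T, ∀ b ∈ T, ‖Y a - Y b‖ ^ 2 ≤ 2 * R ^ 2) (hσ : ∫ a, ‖Y a‖ ^ 2 ∂μ ≤ R ^ 2)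
    {N : ℕ} (hN : 0 < N) {t : ℝ} (ht : R ≤ √N * t) :
    (Measure.pi fun _ : Fin N => μ) {x | N * t ≤ ‖∑ i, Y (x i)‖}
      ≤ ENNReal.ofReal (Real.exp (-(√N * t / R - 1) ^ 2)) := by
  have hN' : (0 : ℝ) < N := by exact_mod_cast hN
  have hs : 0 < √(N : ℝ) := Real.sqrt_pos.2 hN'
  have hss : √(N : ℝ) * √N = N := Real.mul_self_sqrt hN'.le
  -- The minimiser of the Chernoff exponent `-u N t + u √N R + N u² R² / 4`, where `√N R` bounds the
  -- mean and the oscillation is `√2 R`.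
  set u : ℝ := 2 * (√N * t / R - 1) / (√N * R) with hu
  have h1 : 1 ≤ √N * t / R := by rwa [one_le_div hR]
  have hu0 : 0 ≤ u := by
    apply div_nonneg <;> nlinarith [mul_pos hs hR]
  have hmean : meanNorm μ Y N 0 ≤ √N * R := by
    refine abs_le_of_sq_le_sq' ?_ (by positivity) |>.2
    refine (sq_meanNorm_le hY hY2 hY0 N 0).trans ?_
    rw [mul_pow, Real.sq_sqrt hN'.le]
    simp only [norm_zero]
    nlinarith
  have hc' : ∀ a ∈ T, ∀ b ∈ T, ‖Y a - Y b‖ ≤ √2 * R := fun a ha b hb => by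
    refine abs_le_of_sq_le_sq' ?_ (by positivity) |>.2
    rw [mul_pow, Real.sq_sqrt (by norm_num)]
    exact hc a ha b hb
  have hexp := lintegral_exp_norm_sum_le hYm hY hT hc' u N 0
  have hmeas : Measurable fun x : Fin N → α =>
      ENNReal.ofReal (Real.exp (u * ‖0 + ∑ i, Y (x i)‖)) := by
    have : Measurable fun x : Fin N → α => ∑ i, Y (x i) :=
      Finset.measurable_sum _ fun i _ => hYm.comp (measurable_pi_apply i)
    exact (((this.const_add 0).norm.const_mul u).exp).ennreal_ofReal
  have hmarkov := mul_meas_ge_le_lintegral (μ := Measure.pi fun _ : Fin N => μ) hmeas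
    (ENNReal.ofReal (Real.exp (u * (N * t))))
  have hle : (Measure.pi fun _ : Fin N => μ) {x | N * t ≤ ‖∑ i, Y (x i)‖}
      ≤ (Measure.pi fun _ : Fin N => μ) {x | ENNReal.ofReal (Real.exp (u * (N * t)))
        ≤ ENNReal.ofReal (Real.exp (u * ‖0 + ∑ i, Y (x i)‖))} := by
    refine measure_mono fun x hx => ?_
    simp only [Set.mem_ofPred_eq, zero_add] at hx ⊢
    gcongr
  refine hle.trans ?_
  have hpos : ENNReal.ofReal (Real.exp (u * (N * t))) ≠ 0 := by
    simp [Real.exp_pos]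
  rw [← ENNReal.mul_le_mul_iff_right hpos ENNReal.ofReal_ne_top]
  refine hmarkov.trans (hexp.trans ?_)
  rw [← ENNReal.ofReal_mul (Real.exp_nonneg _), ← Real.exp_add]
  refine ENNReal.ofReal_le_ofReal (Real.exp_le_exp.2 ?_)
  have h2 : u * meanNorm μ Y N 0 ≤ u * (√N * R) := mul_le_mul_of_nonneg_left hmean hu0
  have h3 : u * (√N * R) = 2 * (√N * t / R - 1) := by rw [hu]; field_simp
  have h4 : N * (u ^ 2 * (√2 * R) ^ 2 / 8) = (√N * t / R - 1) ^ 2 := by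
    rw [mul_pow, Real.sq_sqrt (by norm_num), hu]
    field_simp
    rw [Real.sq_sqrt hN'.le]; field_simp; norm_num [mul_comm]
  have h5 : u * (N * t) = 2 * (√N * t / R - 1) * (√N * t / R) := by
    have : u * (N * t) = u * (√N * √N * t) := by rw [hss]
    rw [this, ← h3]
    field_simp
  rw [h4, h5]
  rw [h3] at h2
  nlinarith

end Concentration

/-! ### Moment matrices and the deterministic error bound -/

section Moments

/-- The tensor square of a vector, with the Hilbert–Schmidt norm. -/
noncomputable def tensorSquare {ι : Type*} (v : ι → ℝ) : EuclideanSpace ℝ (ι × ι) :=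
  WithLp.toLp 2 fun p => v p.1 * v p.2

theorem continuous_tensorSquare_comp {ι X : Type*} [TopologicalSpace X] {v : X → ι → ℝ}
    (hv : ∀ i, Continuous fun x => v x i) : Continuous fun x => tensorSquare (v x) :=
  (PiLp.continuous_toLp 2 _).comp (continuous_pi fun p => (hv p.1).mul (hv p.2))

section TensorSquare

variable {ι : Type*} [Fintype ι]

theorem inner_tensorSquare (v w : ι → ℝ) :
    inner ℝ (tensorSquare v) (tensorSquare w) = (∑ i, v i * w i) ^ 2 := by
  simp only [PiLp.inner_apply, tensorSquare, sq, Finset.sum_mul_sum, Fintype.sum_prod_type]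
  refine Finset.sum_congr rfl fun i _ => Finset.sum_congr rfl fun j _ => ?_
  simp only [RCLike.inner_apply, conj_trivial]
  ring

theorem norm_tensorSquare (v : ι → ℝ) : ‖tensorSquare v‖ = ∑ i, v i ^ 2 := by
  rw [← Real.sqrt_sq (norm_nonneg (tensorSquare v)), ← real_inner_self_eq_norm_sq,
    inner_tensorSquare, Real.sqrt_sq (Finset.sum_nonneg fun i _ => mul_self_nonneg _)]
  simp only [sq]

/-- Tensor squares have nonnegative inner products, so the triangle inequality's `4 R²` improves to
`2 R²`. -/
theorem sq_norm_tensorSquare_sub_le {v w : ι → ℝ} {R : ℝ} (hv : ‖tensorSquare v‖ ≤ R)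
    (hw : ‖tensorSquare w‖ ≤ R) : ‖tensorSquare v - tensorSquare w‖ ^ 2 ≤ 2 * R ^ 2 := by
  rw [norm_sub_sq_real, inner_tensorSquare]
  have h1 := pow_le_pow_left₀ (norm_nonneg _) hv 2
  have h2 := pow_le_pow_left₀ (norm_nonneg _) hw 2
  nlinarith [sq_nonneg (∑ i, v i * w i)]

end TensorSquare

theorem iInf_eigenvalues_mul_le {ι : Type*} [Fintype ι] [DecidableEq ι]
    {A : Matrix ι ι ℝ} (hA : A.IsHermitian) (c : ι → ℝ) :
    (⨅ i, hA.eigenvalues i) * ∑ i, c i ^ 2 ≤ ∑ i, ∑ j, c i * c j * A i j := by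
  set b := hA.eigenvectorBasis
  set v : EuclideanSpace ℝ ι := WithLp.toLp 2 c
  have hT : ∀ x y : EuclideanSpace ℝ ι, inner ℝ (Matrix.toEuclideanLin A x) y
      = inner ℝ x (Matrix.toEuclideanLin A y) := Matrix.isSymmetric_toEuclideanLin_iff.2 hA
  have hb : ∀ i, Matrix.toEuclideanLin A (b i) = hA.eigenvalues i • b i := fun i => by
    ext j
    have := congrFun (hA.mulVec_eigenvectorBasis i) j
    simpa [Matrix.toLpLin_apply] using this
  have h1 : inner ℝ v (Matrix.toEuclideanLin A v) = ∑ i, ∑ j, c i * c j * A i j := by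
    simp only [PiLp.inner_apply, Matrix.toLpLin_apply, v, Matrix.mulVec, dotProduct,
      RCLike.inner_apply, conj_trivial, Finset.sum_mul]
    refine Finset.sum_congr rfl fun i _ => Finset.sum_congr rfl fun j _ => by ring
  have h2 : inner ℝ v (Matrix.toEuclideanLin A v)
      = ∑ i, hA.eigenvalues i * inner ℝ v (b i) ^ 2 := by
    rw [← b.sum_inner_mul_inner]
    refine Finset.sum_congr rfl fun i _ => ?_
    rw [← hT, hb, real_inner_smul_left, real_inner_comm v (b i)]
    ring
  have h3 : ∑ i, c i ^ 2 = ∑ i, inner ℝ v (b i) ^ 2 := by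
    have : ‖v‖ ^ 2 = ∑ i, c i ^ 2 := by simp [EuclideanSpace.norm_sq_eq, v]
    rw [← this, ← real_inner_self_eq_norm_sq, ← b.sum_inner_mul_inner]
    refine Finset.sum_congr rfl fun i _ => ?_
    rw [real_inner_comm v (b i)]
    ring
  rw [← h1, h2, h3, Finset.mul_sum]
  exact Finset.sum_le_sum fun i _ => mul_le_mul_of_nonneg_right
    (ciInf_le (Set.finite_range _).bddBelow i) (sq_nonneg _)

variable {d : ℕ}

theorem continuous_monomialValue {n : ℕ} (α : MultiIndex d n) :
    Continuous fun x : Fin d → ℝ => monomialValue x α := by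
  unfold monomialValue; fun_prop

/-- The rank-one moment matrix of a point. -/
noncomputable def pointMoments (n : ℕ) (x : Fin d → ℝ) :
    EuclideanSpace ℝ (MultiIndex d n × MultiIndex d n) :=
  tensorSquare fun α => monomialValue x α

theorem continuous_pointMoments (n : ℕ) : Continuous (pointMoments (d := d) n) :=
  continuous_tensorSquare_comp continuous_monomialValue

theorem integrable_of_continuous {E : Type*} [NormedAddCommGroup E]
    [SecondCountableTopology E] {μ : Measure (Fin d → ℝ)} [IsFiniteMeasure μ]
    {S : Set (Fin d → ℝ)} (hS : IsCompact S) (hμ : μ Sᶜ = 0) {f : (Fin d → ℝ) → E}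
    (hf : Continuous f) : Integrable f μ := by
  borelize E
  obtain ⟨C, hC⟩ := hS.exists_bound_of_continuousOn hf.continuousOn
  refine Integrable.mono' (integrable_const C) hf.aestronglyMeasurable ?_
  have : ∀ᵐ x ∂μ, x ∈ S := mem_ae_iff.2 hμ
  exact this.mono hC

theorem integral_pointMoments_apply {μ : Measure (Fin d → ℝ)} [IsFiniteMeasure μ]
    {S : Set (Fin d → ℝ)} (hS : IsCompact S) (hμ : μ Sᶜ = 0) (n : ℕ)
    (p : MultiIndex d n × MultiIndex d n) :
    (∫ x, pointMoments n x ∂μ) p = ∫ x, pointMoments n x p ∂μ :=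
  ((EuclideanSpace.proj p : EuclideanSpace ℝ (MultiIndex d n × MultiIndex d n) →L[ℝ] ℝ)
    |>.integral_comp_comm
    (integrable_of_continuous hS hμ (continuous_pointMoments n))).symm

theorem integral_pointMoments_eq_momentMatrix {μ : Measure (Fin d → ℝ)} [IsFiniteMeasure μ]
    {S : Set (Fin d → ℝ)} (hS : IsCompact S) (hμ : μ Sᶜ = 0) (n : ℕ)
    (α β : MultiIndex d n) : (∫ x, pointMoments n x ∂μ) (α, β) = momentMatrix n μ α β := by
  rw [integral_pointMoments_apply hS hμ]
  refine integral_congr_ae (ae_of_all _ fun x => ?_)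
  simp [pointMoments, tensorSquare, monomialValue, ← Finset.prod_mul_distrib, pow_add]

theorem inner_tensorSquare_integral_pointMoments {μ : Measure (Fin d → ℝ)} [IsFiniteMeasure μ]
    {S : Set (Fin d → ℝ)} (hS : IsCompact S) (hμ : μ Sᶜ = 0) {n : ℕ}
    (c : MultiIndex d n → ℝ) : inner ℝ (tensorSquare c) (∫ x, pointMoments n x ∂μ)
      = ∑ α, ∑ β, c α * c β * momentMatrix n μ α β := by
  simp only [PiLp.inner_apply, Fintype.sum_prod_type, tensorSquare,
    integral_pointMoments_eq_momentMatrix hS hμ, RCLike.inner_apply, conj_trivial]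
  exact Finset.sum_congr rfl fun i _ => Finset.sum_congr rfl fun j _ => by ring

theorem minEigenvalue_mul_le {μ : Measure (Fin d → ℝ)} [IsFiniteMeasure μ]
    {S : Set (Fin d → ℝ)} (hS : IsCompact S) (hμ : μ Sᶜ = 0) {n : ℕ}
    (c : MultiIndex d n → ℝ) : minEigenvalue n μ * ∑ α, c α ^ 2
      ≤ inner ℝ (tensorSquare c) (∫ x, pointMoments n x ∂μ) := by
  rw [inner_tensorSquare_integral_pointMoments hS hμ]
  exact iInf_eigenvalues_mul_le (momentMatrix_isHermitian n μ) c

instance (n : ℕ) : Nonempty (MultiIndex d n) := ⟨⟨fun _ => 0, by simp⟩⟩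

/-- The quadratic form at `c` is the integral of the square of the polynomial with coefficients `c`,
whose zero set is Lebesgue null and hence `μ`-null. -/
theorem minEigenvalue_pos {μ : Measure (Fin d → ℝ)} [IsProbabilityMeasure μ]
    {S : Set (Fin d → ℝ)} (hS : IsCompact S) (hμ : μ Sᶜ = 0) (hac : μ ≪ volume) (n : ℕ) :
    0 < minEigenvalue n μ := by
  have hpos : (momentMatrix n μ).PosDef := by
    refine Matrix.PosDef.of_dotProduct_mulVec_pos (momentMatrix_isHermitian n μ) fun c hc => ?_
    have h1 : star c ⬝ᵥ (momentMatrix n μ).mulVec c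
        = ∫ x, (∑ α, c α * monomialValue x α) ^ 2 ∂μ := by
      have h2 := (inner_tensorSquare_integral_pointMoments hS hμ c).symm.trans
        (integral_inner (integrable_of_continuous hS hμ (continuous_pointMoments n)) _).symm
      simp only [pointMoments, inner_tensorSquare] at h2
      rw [← h2]
      simp only [dotProduct, Matrix.mulVec, Pi.star_apply, star_trivial, Finset.mul_sum]
      exact Finset.sum_congr rfl fun i _ => Finset.sum_congr rfl fun j _ => by ring
    have hcont : Continuous fun x : Fin d → ℝ => (∑ α, c α * monomialValue x α) ^ 2 :=
      (continuous_finsetSum _ fun α _ =>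
        continuous_const.mul (continuous_monomialValue α)).pow 2
    rw [h1, integral_pos_iff_support_of_nonneg (fun x => sq_nonneg _)
      (integrable_of_continuous hS hμ hcont)]
    have hz := hac (volume_zeros_sum_monomialValue hc)
    have hsupp : (Function.support fun x : Fin d → ℝ => (∑ α, c α * monomialValue x α) ^ 2)
        = {x | ∑ α, c α * monomialValue x α = 0}ᶜ := by
      ext x; simp
    rw [hsupp, pos_iff_ne_zero]
    intro h
    have h3 := measure_union_le (μ := μ) {x : Fin d → ℝ | ∑ α, c α * monomialValue x α = 0}
      {x : Fin d → ℝ | ∑ α, c α * monomialValue x α = 0}ᶜ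
    rw [Set.union_compl_self, measure_univ, hz, h] at h3
    simp at h3
  obtain ⟨i, hi⟩ := exists_eq_ciInf_of_finite
    (f := (momentMatrix_isHermitian n μ).eigenvalues)
  rw [minEigenvalue, ← hi]
  exact hpos.eigenvalues_pos i

/-- A lower bound for the empirical quadratic form in terms of the Hilbert–Schmidt distance
between the empirical and the exact moment matrix. -/
theorem mul_sum_sq_le_sum_sq_div {μ : Measure (Fin d → ℝ)} [IsFiniteMeasure μ]
    {S : Set (Fin d → ℝ)} (hS : IsCompact S) (hμ : μ Sᶜ = 0) {n N : ℕ}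
    (x : Fin N → Fin d → ℝ) (c : MultiIndex d n → ℝ) :
    (minEigenvalue n μ
        - ‖(N : ℝ)⁻¹ • ∑ i, pointMoments n (x i) - ∫ y, pointMoments n y ∂μ‖) * ∑ α, c α ^ 2
      ≤ (N : ℝ)⁻¹ * ∑ i, (∑ α, c α * monomialValue (x i) α) ^ 2 := by
  have h1 : inner ℝ (tensorSquare c) ((N : ℝ)⁻¹ • ∑ i, pointMoments n (x i))
      = (N : ℝ)⁻¹ * ∑ i, (∑ α, c α * monomialValue (x i) α) ^ 2 := by
    simp only [inner_smul_right, inner_sum, pointMoments, inner_tensorSquare]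
  have h2 := minEigenvalue_mul_le hS hμ c
  -- A quadratic form at `c` is the pairing of its matrix with the tensor square of `c`, of norm `∑
  -- c α ^ 2`, so one Cauchy–Schwarz handles all `c` at once.
  have h3 := abs_real_inner_le_norm (tensorSquare c)
    ((N : ℝ)⁻¹ • ∑ i, pointMoments n (x i) - ∫ y, pointMoments n y ∂μ)
  rw [norm_tensorSquare, inner_sub_right, h1] at h3
  have h4 := (abs_le.1 h3).1
  linarith

/-- Monomials are real at real points, so the real quadratic form applies separately to the real and
imaginary parts of the coefficients. -/
theorem mul_sum_sq_norm_coeff_le {n N : ℕ} {x : Fin N → Fin d → ℝ} {κ : ℝ}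
    (h : ∀ c : MultiIndex d n → ℝ, κ * ∑ α, c α ^ 2
      ≤ (N : ℝ)⁻¹ * ∑ i, (∑ α, c α * monomialValue (x i) α) ^ 2)
    {Q : MvPolynomial (Fin d) ℂ} (hQ : Q.totalDegree ≤ n) :
    κ * ∑ α : MultiIndex d n, ‖MvPolynomial.coeff α.exponent Q‖ ^ 2
      ≤ (N : ℝ)⁻¹ * ∑ i, ‖MvPolynomial.eval (toComplex (x i)) Q‖ ^ 2 := by
  have hmono : ∀ i (α : MultiIndex d n), monomialValue (toComplex (x i)) α
      = ((monomialValue (x i) α : ℝ) : ℂ) := fun i α => by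
    simp [monomialValue, toComplex]
  have hnorm : ∀ w : ℂ, ‖w‖ ^ 2 = w.re ^ 2 + w.im ^ 2 := fun w => by
    rw [Complex.sq_norm, Complex.normSq_apply]; ring
  have hre := h fun α => (MvPolynomial.coeff α.exponent Q).re
  have him := h fun α => (MvPolynomial.coeff α.exponent Q).im
  have heval : ∀ i, ‖MvPolynomial.eval (toComplex (x i)) Q‖ ^ 2
      = (∑ α : MultiIndex d n, (MvPolynomial.coeff α.exponent Q).re * monomialValue (x i) α) ^ 2
      + (∑ α : MultiIndex d n,
          (MvPolynomial.coeff α.exponent Q).im * monomialValue (x i) α) ^ 2 := fun i => by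
    rw [eval_eq_sum_multiIndex hQ, hnorm]
    simp [hmono, Complex.re_sum, Complex.im_sum]
  simp only [heval, hnorm, Finset.sum_add_distrib, mul_add]
  exact add_le_add hre him

/-- The deterministic error bound for truncated least-squares polynomials. -/
theorem norm_eval_truncation_sub_le {n N m : ℕ} {x : Fin N → Fin d → ℝ} {κ : ℝ} (hκ : 0 < κ)
    (h : ∀ c : MultiIndex d n → ℝ, κ * ∑ α, c α ^ 2
      ≤ (N : ℝ)⁻¹ * ∑ i, (∑ α, c α * monomialValue (x i) α) ^ 2)
    {g : (Fin d → ℂ) → ℂ} {P T : MvPolynomial (Fin d) ℂ} (hP : IsLeastSquares n x g P)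
    (hT : T.totalDegree ≤ n) {J : ℝ} (hJ : (N : ℝ)⁻¹ * residual x g T ≤ J)
    {z : Fin d → ℂ} {B : ℝ} (hB : ∑ i, ‖z i‖ ^ 2 ≤ B) :
    ‖MvPolynomial.eval z (truncation m P) - MvPolynomial.eval z (truncation m T)‖
      ≤ √(4 * Real.exp B) * (√(m.factorial : ℝ) * √(J / κ)) := by
  have hQ : (P - T).totalDegree ≤ n :=
    (MvPolynomial.totalDegree_sub _ _).trans (max_le hP.1 hT)
  have h1 := mul_sum_sq_norm_coeff_le h hQ
  have h2 := mul_le_mul_of_nonneg_left (sum_sq_norm_eval_sub_le hP hT)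
    (inv_nonneg.2 (Nat.cast_nonneg (α := ℝ) N))
  have h3 : ∑ α : MultiIndex d n, ‖MvPolynomial.coeff α.exponent (P - T)‖ ^ 2 ≤ 4 * (J / κ) := by
    rw [mul_div_assoc', le_div_iff₀ hκ]
    linarith
  rw [← map_sub, ← truncation_sub, ← Real.sqrt_mul (Nat.cast_nonneg _),
    ← Real.sqrt_mul (by positivity)]
  refine Real.le_sqrt_of_sq_le ((sq_norm_eval_truncation_le m hQ z).trans ?_)
  have h4 : m.factorial * Real.exp (∑ i, ‖z i‖ ^ 2) ≤ m.factorial * Real.exp B := by gcongr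
  calc _ ≤ 4 * (J / κ) * (m.factorial * Real.exp B) :=
        mul_le_mul h3 h4 (by positivity)
          ((Finset.sum_nonneg fun _ _ => sq_nonneg _).trans h3)
    _ = _ := by ring

end Moments

/-! ### Convergence of empirical moments, random and deterministic -/

section Sampling

variable {d : ℕ}

theorem isometry_toComplex : Isometry (toComplex : (Fin d → ℝ) → Fin d → ℂ) := by
  refine Isometry.of_dist_eq fun x y => ?_
  simp only [toComplex, dist_pi_def]
  congr 2
  ext i
  simp [nndist_eq_nnnorm, ← Complex.ofReal_sub]

theorem isCompact_realPart {K : Set (Fin d → ℂ)} (hK : IsCompact K) : IsCompact (realPart K) :=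
  isometry_toComplex.isClosedEmbedding.isCompact_preimage hK

theorem support_subset_of_isCompact {μ : Measure (Fin d → ℝ)} {S : Set (Fin d → ℝ)}
    (hS : IsCompact S) (hμ : μ Sᶜ = 0) : μ.support ⊆ S :=
  Measure.support_subset_of_isClosed hS.isClosed (mem_ae_iff.2 hμ)

theorem abs_monomialValue_le {n : ℕ} {x : Fin d → ℝ} {L : ℝ} (hL : 1 ≤ L) (hx : ‖x‖ ≤ L)
    (α : MultiIndex d n) : |monomialValue x α| ≤ L ^ n := by
  rw [monomialValue, Finset.abs_prod]
  calc ∏ i, |x i ^ (α.1 i : ℕ)| ≤ ∏ i, L ^ (α.1 i : ℕ) := by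
        refine Finset.prod_le_prod (fun i _ => abs_nonneg _) fun i _ => ?_
        rw [abs_pow]
        exact pow_le_pow_left₀ (abs_nonneg _) ((norm_le_pi_norm x i).trans hx) _
    _ = L ^ ∑ i, (α.1 i : ℕ) := Finset.prod_pow_eq_pow_sum _ _ _
    _ ≤ L ^ n := pow_le_pow_right₀ hL α.2

theorem norm_pointMoments_le {n : ℕ} {x : Fin d → ℝ} {L : ℝ} (hL : 1 ≤ L) (hx : ‖x‖ ≤ L) :
    ‖pointMoments n x‖ ≤ numMultiIndex d n * L ^ (2 * n) := by
  rw [pointMoments, norm_tensorSquare, numMultiIndex, ← nsmul_eq_mul]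
  refine Finset.sum_le_card_nsmul _ _ _ fun α _ => ?_
  rw [mul_comm 2 n, pow_mul, ← sq_abs]
  exact pow_le_pow_left₀ (abs_nonneg _) (abs_monomialValue_le hL hx α) 2

theorem norm_le_supportRadius {μ : Measure (Fin d → ℝ)} {S : Set (Fin d → ℝ)}
    (hS : IsCompact S) (hμ : μ Sᶜ = 0) {x : Fin d → ℝ} (hx : x ∈ μ.support) :
    ‖x‖ ≤ supportRadius μ := by
  refine le_max_of_le_right (le_csSup ?_ ⟨x, hx, rfl⟩)
  exact ((hS.image continuous_norm).bddAbove).mono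
    (Set.image_mono (support_subset_of_isCompact hS hμ))

theorem integral_sq_norm_sub_integral_le {α E : Type*} [MeasurableSpace α]
    [NormedAddCommGroup E] [InnerProductSpace ℝ E] [CompleteSpace E] {μ : Measure α}
    [IsProbabilityMeasure μ] {Z : α → E} (hZ : Integrable Z μ)
    (hZ2 : Integrable (fun a => ‖Z a‖ ^ 2) μ) :
    ∫ a, ‖Z a - ∫ b, Z b ∂μ‖ ^ 2 ∂μ ≤ ∫ a, ‖Z a‖ ^ 2 ∂μ := by
  set e := ∫ b, Z b ∂μ with he
  have hin : Integrable (fun a => 2 * inner ℝ e (Z a) - ‖e‖ ^ 2) μ :=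
    ((hZ.const_inner e).const_mul 2).sub (integrable_const _)
  have h1 : (fun a => ‖Z a - e‖ ^ 2) = fun a => ‖Z a‖ ^ 2 - (2 * inner ℝ e (Z a) - ‖e‖ ^ 2) := by
    ext a
    rw [norm_sub_sq_real, real_inner_comm]
    ring
  rw [h1, integral_sub hZ2 hin,
    integral_sub ((hZ.const_inner e).const_mul 2) (integrable_const _), integral_const_mul,
    integral_inner hZ, ← he, real_inner_self_eq_norm_sq]
  simp only [integral_const, probReal_univ, one_smul]
  nlinarith [sq_nonneg ‖e‖]

/-- With `y = √N Λ / (2R)` the sample size gives `y² ≥ log (2/δ)`, and the claim reduces to `(7y/4 -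
1)² ≥ y² - log 2`. This quadratic inequality holds for all `y`, the difference being smallest at `y
= 28/33`. With `1/2` in place of `7/8` it would fail for large `y`. -/
theorem exp_neg_sq_le {R Λ δ : ℝ} (hR : 0 < R) (hΛ : 0 < Λ) (hδ : 0 < δ) (hδ1 : δ < 1) {N : ℕ}
    (hN : R ^ 2 / Λ ^ 2 * (4 * Real.log (2 / δ)) ≤ N) :
    R ≤ √N * (7 / 8 * Λ) ∧ Real.exp (-(√N * (7 / 8 * Λ) / R - 1) ^ 2) ≤ δ := by
  set y := √N * Λ / (2 * R) with hy
  have hy0 : 0 ≤ y := by positivity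
  have hlog : Real.log (2 / δ) = Real.log 2 - Real.log δ :=
    Real.log_div two_ne_zero hδ.ne'
  have hδl : Real.log δ < 0 := Real.log_neg hδ hδ1
  have h2 := Real.log_two_gt_d9
  have hysq : Real.log (2 / δ) ≤ y ^ 2 := by
    rw [hy, div_pow, mul_pow, Real.sq_sqrt (Nat.cast_nonneg _), le_div_iff₀ (by positivity)]
    rw [div_mul_eq_mul_div, div_le_iff₀ (by positivity)] at hN
    linarith
  have hq : √N * (7 / 8 * Λ) / R = 7 / 4 * y := by rw [hy]; field_simp; ring
  have hy1 : 4 / 7 ≤ y := by nlinarith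
  refine ⟨?_, ?_⟩
  · rw [← one_le_div hR, hq]; linarith
  · rw [hq, ← Real.le_log_iff_exp_le hδ]
    nlinarith [sq_nonneg (y - 28 / 33)]

/-- With high probability, the empirical moment matrix of an independent sample is close to the
moment matrix, relative to the smallest eigenvalue of the latter. -/
theorem exists_measurableSet_norm_sub_lt {μ : Measure (Fin d → ℝ)} [IsProbabilityMeasure μ]
    {S : Set (Fin d → ℝ)} (hS : IsCompact S) (hμ : μ Sᶜ = 0) {n : ℕ}
    (hΛ : 0 < minEigenvalue n μ) {Ω : Type*} [MeasurableSpace Ω] {ν : Measure Ω}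
    [IsProbabilityMeasure ν] {δ : ℝ} (hδ : 0 < δ) (hδ1 : δ < 1) {N : ℕ}
    (hN : supportRadius μ ^ (4 * n) * (numMultiIndex d n : ℝ) ^ 2 /
      minEigenvalue n μ ^ 2 * (4 * Real.log (2 / δ)) ≤ N)
    {X : Fin N → Ω → Fin d → ℝ} (hX : ∀ i, HasLaw (X i) μ ν) (hind : iIndepFun X ν) :
    ∃ A : Set Ω, MeasurableSet A ∧ ENNReal.ofReal (1 - δ) ≤ ν A ∧ ∀ ω ∈ A,
      (∀ i, X i ω ∈ μ.support) ∧
      ‖(N : ℝ)⁻¹ • ∑ i, pointMoments n (X i ω) - ∫ y, pointMoments n y ∂μ‖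
        < 7 / 8 * minEigenvalue n μ := by
  set Λ := minEigenvalue n μ
  set R : ℝ := numMultiIndex d n * supportRadius μ ^ (2 * n) with hRdef
  have hL : 1 ≤ supportRadius μ := le_max_left _ _
  have hr : (0 : ℝ) < numMultiIndex d n := by
    exact_mod_cast (Fintype.card_pos : 0 < Fintype.card (MultiIndex d n))
  have hR : 0 < R := by positivity
  have hR2 : R ^ 2 = supportRadius μ ^ (4 * n) * (numMultiIndex d n : ℝ) ^ 2 := by
    rw [hRdef, mul_pow, ← pow_mul]; ring_nf
  rw [← hR2] at hN
  obtain ⟨ht, hexp⟩ := exp_neg_sq_le hR hΛ hδ hδ1 hN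
  have hN0 : 0 < N := by
    rcases Nat.eq_zero_or_pos N with rfl | h
    · simp at ht; linarith
    · exact h
  have hN' : (0 : ℝ) < N := by exact_mod_cast hN0
  set e := ∫ y, pointMoments n y ∂μ with he
  set Y : (Fin d → ℝ) → EuclideanSpace ℝ (MultiIndex d n × MultiIndex d n) :=
    fun x => pointMoments n x - e with hYdef
  have hYc : Continuous Y := (continuous_pointMoments n).sub continuous_const
  have hZi := integrable_of_continuous hS hμ (continuous_pointMoments n)
  have hZ2 := integrable_of_continuous hS hμ ((continuous_pointMoments n).norm.pow 2)
  have hsupp : ∀ᵐ x ∂μ, x ∈ μ.support := Measure.support_mem_ae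
  have hZR : ∀ x ∈ μ.support, ‖pointMoments n x‖ ≤ R := fun x hx =>
    norm_pointMoments_le hL (norm_le_supportRadius hS hμ hx)
  have hY0 : ∫ x, Y x ∂μ = 0 := by
    rw [integral_sub hZi (integrable_const _)]; simp [he]
  have hσ : ∫ x, ‖Y x‖ ^ 2 ∂μ ≤ R ^ 2 := by
    refine (integral_sq_norm_sub_integral_le hZi hZ2).trans ?_
    have h := integral_mono_ae hZ2 (integrable_const (R ^ 2))
      (hsupp.mono fun x hx => pow_le_pow_left₀ (norm_nonneg _) (hZR x hx) 2)
    simpa using h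
  have hconc := measure_pi_norm_sum_ge_le hYc.measurable
    (integrable_of_continuous hS hμ hYc) (integrable_of_continuous hS hμ (hYc.norm.pow 2)) hY0
    hsupp hR (fun a ha b hb => by
      simp only [hYdef, sub_sub_sub_cancel_right]
      exact sq_norm_tensorSquare_sub_le (hZR a ha) (hZR b hb)) hσ hN0 ht
  set f : Ω → Fin N → Fin d → ℝ := fun ω i => X i ω with hf
  have hfm : AEMeasurable f ν := aemeasurable_pi_lambda _ fun i => (hX i).aemeasurable
  have hmap : ν.map f = Measure.pi fun _ : Fin N => μ := by
    rw [(iIndepFun_iff_map_fun_eq_pi_map fun i => (hX i).aemeasurable).1 hind]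
    congr 1
    ext1 i
    exact (hX i).map_eq
  -- Membership of the samples in the support is kept in the event: the Taylor error is bounded by
  -- `R_μ` only there.
  set G₁ : Set (Fin N → Fin d → ℝ) := {x | ∀ i, x i ∈ μ.support} with hG₁
  set G₂ : Set (Fin N → Fin d → ℝ) := {x | N * (7 / 8 * Λ) ≤ ‖∑ i, Y (x i)‖} with hG₂
  have hm₁ : MeasurableSet G₁ := by
    have : G₁ = ⋂ i, (fun x : Fin N → Fin d → ℝ => x i) ⁻¹' μ.support := by
      ext x; simp [hG₁]
    rw [this]
    exact MeasurableSet.iInter fun i =>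
      (measurable_pi_apply i) Measure.isClosed_support.measurableSet
  have hm₂ : MeasurableSet G₂ := by
    refine (isClosed_le continuous_const (Continuous.norm ?_)).measurableSet
    exact continuous_finsetSum _ fun i _ => hYc.comp (continuous_apply i)
  have hp₁ : (Measure.pi fun _ : Fin N => μ) G₁ᶜ = 0 := by
    have h : ∀ i : Fin N, ∀ᵐ x ∂(Measure.pi fun _ : Fin N => μ), x i ∈ μ.support := fun i =>
      (measurePreserving_eval (fun _ : Fin N => μ) i).quasiMeasurePreserving.ae hsupp
    exact mem_ae_iff.1 (ae_all_iff.2 h)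
  have hG : ENNReal.ofReal (1 - δ) ≤ (Measure.pi fun _ : Fin N => μ) (G₁ ∩ G₂ᶜ) := by
    have h1 : (Measure.pi fun _ : Fin N => μ) (G₁ ∩ G₂ᶜ)ᶜ ≤ ENNReal.ofReal δ := by
      rw [Set.compl_inter, compl_compl]
      refine (measure_union_le _ _).trans ?_
      rw [hp₁, zero_add]
      exact hconc.trans (ENNReal.ofReal_le_ofReal hexp)
    have h2 := prob_add_prob_compl (μ := Measure.pi fun _ : Fin N => μ) (hm₁.inter hm₂.compl)
    rw [ENNReal.ofReal_sub _ hδ.le, ENNReal.ofReal_one, tsub_le_iff_right, ← h2]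
    gcongr
  have hnull : NullMeasurableSet (f ⁻¹' (G₁ ∩ G₂ᶜ)) ν :=
    hfm.nullMeasurable (hm₁.inter hm₂.compl)
  -- The samples are only almost everywhere measurable, so the preimage is shrunk to a measurable
  -- set of the same measure.
  obtain ⟨A, hA, hAm, hAe⟩ := hnull.exists_measurable_subset_ae_eq
  refine ⟨A, hAm, ?_, fun ω hω => ⟨(hA hω).1, ?_⟩⟩
  · rw [measure_congr hAe, ← Measure.map_apply_of_aemeasurable hfm (hm₁.inter hm₂.compl), hmap]
    exact hG
  · have h : ‖∑ i, Y (X i ω)‖ < N * (7 / 8 * Λ) := not_le.1 (hA hω).2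
    have h2 : (N : ℝ)⁻¹ • ∑ i, pointMoments n (X i ω) - e = (N : ℝ)⁻¹ • ∑ i, Y (X i ω) := by
      simp only [hYdef, Finset.sum_sub_distrib, Finset.sum_const, Finset.card_univ,
        Fintype.card_fin, smul_sub, ← Nat.cast_smul_eq_nsmul ℝ, smul_smul,
        inv_mul_cancel₀ hN'.ne', one_smul]
    rw [h2, norm_smul, Real.norm_of_nonneg (by positivity), inv_mul_lt_iff₀ hN']
    exact h

theorem tendsto_average_of_weaklyConverges {μ : Measure (Fin d → ℝ)} {S : Set (Fin d → ℝ)}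
    (hS : IsCompact S) (hμ : μ Sᶜ = 0) {x : ℕ → Fin d → ℝ} (hx : ∀ i, x i ∈ S)
    (hw : WeaklyConverges (empiricalMeasure x) μ) {f : (Fin d → ℝ) → ℝ}
    (hf : ContinuousOn f S) :
    Tendsto (fun N : ℕ => (N : ℝ)⁻¹ * ∑ i : Fin N, f (x i)) atTop (𝓝 (∫ y, f y ∂μ)) := by
  have : CompactSpace S := isCompact_iff_compactSpace.1 hS
  -- Tietze extension: `f` is controlled only on `S`, while weak convergence needs a bounded
  -- continuous function on the whole space. The samples and `μ` see only `S`.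
  obtain ⟨h, -, hh⟩ := BoundedContinuousFunction.exists_norm_eq_domRestrict_eq_of_closed
    (BoundedContinuousFunction.mkOfCompact ⟨S.domRestrict f, hf.domRestrict⟩) hS.isClosed
  have hval : ∀ y ∈ S, h y = f y := fun y hy => DFunLike.congr_fun hh ⟨y, hy⟩
  have hint : ∫ y, h y ∂μ = ∫ y, f y ∂μ :=
    integral_congr_ae (Filter.Eventually.mono (mem_ae_iff.2 hμ) hval)
  rw [← hint]
  refine (hw h).congr fun N => ?_
  rw [empiricalMeasure, integral_smul_measure, integral_finsetSum_measure fun i _ =>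
    h.integrable _]
  simp only [integral_dirac, ENNReal.toReal_inv, ENNReal.toReal_natCast, smul_eq_mul]
  rw [Finset.sum_range]
  simp only [hval _ (hx _)]

theorem tendsto_average_pointMoments {μ : Measure (Fin d → ℝ)} [IsFiniteMeasure μ]
    {S : Set (Fin d → ℝ)} (hS : IsCompact S) (hμ : μ Sᶜ = 0) {x : ℕ → Fin d → ℝ}
    (hx : ∀ i, x i ∈ S) (hw : WeaklyConverges (empiricalMeasure x) μ) (n : ℕ) :
    Tendsto (fun N : ℕ => (N : ℝ)⁻¹ • ∑ i : Fin N, pointMoments n (x i)) atTop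
      (𝓝 (∫ y, pointMoments n y ∂μ)) := by
  have h : Tendsto (fun N : ℕ => ((N : ℝ)⁻¹ • ∑ i : Fin N, pointMoments n (x i)).ofLp) atTop
      (𝓝 (∫ y, pointMoments n y ∂μ).ofLp) := by
    refine tendsto_pi_nhds.2 fun p => ?_
    rw [integral_pointMoments_apply hS hμ]
    have hc : Continuous fun y : Fin d → ℝ => pointMoments n y p :=
      (EuclideanSpace.proj p : EuclideanSpace ℝ (MultiIndex d n × MultiIndex d n) →L[ℝ] ℝ)
        |>.continuous.comp (continuous_pointMoments n)
    refine (tendsto_average_of_weaklyConverges hS hμ hx hw hc.continuousOn).congr fun N => ?_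
    simp
  exact ((PiLp.continuous_toLp 2 _).tendsto _).comp h

end Sampling

/-! ### Suprema of the gauge and of the error -/

section ErrorBounds

variable {d : ℕ}

theorem gauge_le_supGauge {K A : Set (Fin d → ℂ)} (hA : A ⊆ K) {z : Fin d → ℂ} (hz : z ∈ A) :
    gauge K z ≤ supGauge K A :=
  le_csSup ⟨1, by rintro _ ⟨w, hw, rfl⟩; exact gauge_le_one_of_mem (hA hw)⟩ ⟨z, hz, rfl⟩

theorem supGauge_nonneg (K A : Set (Fin d → ℂ)) : 0 ≤ supGauge K A :=
  Real.sSup_nonneg (by rintro _ ⟨w, _, rfl⟩; exact gauge_nonneg w)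

theorem uniformError_le {K : Set (Fin d → ℂ)} {P : MvPolynomial (Fin d) ℂ}
    {g : (Fin d → ℂ) → ℂ} {a : ℝ} (h : ∀ z ∈ K, ‖MvPolynomial.eval z P - g z‖ ≤ a) :
    uniformError K P g ≤ ENNReal.ofReal a := by
  refine iSup₂_le fun z hz => ?_
  rw [← ofReal_norm]
  exact ENNReal.ofReal_le_ofReal (h z hz)

end ErrorBounds

end LSApprox

/-! ### The main theorem -/

theorem theorem5p2 {d : ℕ}
    -- the compact absolutely convex neighbourhood of the origin
    (K₀ : Set (Fin d → ℂ)) (hK₀ : IsCompact K₀) (hK₀_nhds : K₀ ∈ 𝓝 0)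
    (hK₀_conv : LSApprox.IsAbsConvex K₀)
    -- an analytic function on `K₀` (holomorphic on some open neighbourhood of `K₀`)
    (g : (Fin d → ℂ) → ℂ) (hg : AnalyticOnNhd ℂ g K₀)
    -- an absolutely continuous probability measure on `K₀ ∩ ℝ^d`
    (μ : Measure (Fin d → ℝ)) [IsProbabilityMeasure μ]
    (hμ_supp : μ (LSApprox.realPart K₀)ᶜ = 0) (hμ_ac : μ ≪ volume)
    -- a compact set relatively compact in `K₀`
    (K₁ : Set (Fin d → ℂ)) (hK₁ : IsCompact K₁) (hK₁_sub : K₁ ⊆ interior K₀) :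
    ∃ C' : ℝ, 0 < C' ∧
      -- deterministic samples whose empirical measures converge weakly to `μ`
      (∀ x : ℕ → Fin d → ℝ, (∀ i, x i ∈ LSApprox.realPart K₀) →
        LSApprox.WeaklyConverges (LSApprox.empiricalMeasure x) μ →
        ∀ m n : ℕ, m ≤ n →
        ∀ P : ℕ → MvPolynomial (Fin d) ℂ,
          (∀ N, LSApprox.IsLeastSquares n (fun i : Fin N => x i) g (P N)) →
          limsup (fun N => LSApprox.uniformError K₁ (LSApprox.truncation m (P N)) g) atTop ≤
            ENNReal.ofReal (C' *
              (√(m.factorial : ℝ) * (LSApprox.supGauge K₀ (LSApprox.toComplex '' μ.support) ^ n /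
                  √(LSApprox.minEigenvalue n μ))
                + LSApprox.supGauge K₀ K₁ ^ m))) ∧
      -- independent samples with distribution `μ`
      (∀ (Ω : Type*) [MeasurableSpace Ω] (ν : Measure Ω) [IsProbabilityMeasure ν]
        (δ : ℝ), 0 < δ → δ < 1 →
        ∀ m n N : ℕ, m ≤ n →
        (N : ℝ) ≥ LSApprox.supportRadius μ ^ (4 * n) * (LSApprox.numMultiIndex d n : ℝ) ^ 2 /
            LSApprox.minEigenvalue n μ ^ 2 * (4 * Real.log (2 / δ)) →
        ∀ X : Fin N → Ω → Fin d → ℝ,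
          (∀ i, HasLaw (X i) μ ν) → iIndepFun X ν →
          ∃ A : Set Ω, MeasurableSet A ∧ ENNReal.ofReal (1 - δ) ≤ ν A ∧
            ∀ ω ∈ A, ∀ P : MvPolynomial (Fin d) ℂ,
              LSApprox.IsLeastSquares n (fun i => X i ω) g P →
              LSApprox.uniformError K₁ (LSApprox.truncation m P) g ≤
                ENNReal.ofReal (C' *
                  (√(2 * (m.factorial : ℝ)) *
                      (LSApprox.supGauge K₀ (LSApprox.toComplex '' μ.support) ^ n /
                        √(LSApprox.minEigenvalue n μ))
                    + LSApprox.supGauge K₀ K₁ ^ m))) := by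
  open LSApprox in
  obtain ⟨T, M, hM, hTdeg, hTtrunc, hTerr⟩ :=
    exists_taylorPolynomial hK₀ hK₀_nhds hK₀_conv hg
  have hS := isCompact_realPart hK₀
  have hsub := support_subset_of_isCompact hS hμ_supp
  obtain ⟨B, hB⟩ := hK₁.exists_bound_of_continuousOn (f := fun z : Fin d → ℂ => ∑ i, ‖z i‖ ^ 2)
    (by fun_prop)
  have hB' : ∀ z ∈ K₁, ∑ i, ‖z i‖ ^ 2 ≤ B := fun z hz => (le_abs_self _).trans (hB z hz)
  have hK₁' : K₁ ⊆ K₀ := hK₁_sub.trans interior_subset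
  set ϱ := supGauge K₀ (toComplex '' μ.support) with hϱ
  set ϱ₁ := supGauge K₀ K₁ with hϱ₁
  have hϱ0 : 0 ≤ ϱ := supGauge_nonneg _ _
  have hϱ₁0 : 0 ≤ ϱ₁ := supGauge_nonneg _ _
  have hΛ : ∀ n, 0 < minEigenvalue n μ := minEigenvalue_pos hS hμ_supp hμ_ac
  have hTsupp : ∀ n, ∀ y ∈ μ.support,
      ‖MvPolynomial.eval (toComplex y) (T n) - g (toComplex y)‖ ^ 2 ≤ (M * ϱ ^ n) ^ 2 :=
    fun n y hy => by
      refine pow_le_pow_left₀ (norm_nonneg _) ((hTerr n _ (hsub hy)).trans ?_) 2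
      refine mul_le_mul_of_nonneg_left (pow_le_pow_left₀ (gauge_nonneg _) ?_ n) hM
      refine gauge_le_supGauge ?_ ⟨y, hy, rfl⟩
      rintro _ ⟨w, hw, rfl⟩
      exact hsub hw
  have herr : ∀ {m n N : ℕ} {x : Fin N → Fin d → ℝ} {κ J : ℝ} {P : MvPolynomial (Fin d) ℂ},
      m ≤ n → 0 < κ → (∀ c : MultiIndex d n → ℝ, κ * ∑ α, c α ^ 2
        ≤ (N : ℝ)⁻¹ * ∑ i, (∑ α, c α * monomialValue (x i) α) ^ 2) →
      IsLeastSquares n x g P → (N : ℝ)⁻¹ * residual x g (T n) ≤ J →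
      uniformError K₁ (truncation m P) g ≤ ENNReal.ofReal
        (√(4 * Real.exp B) * (√(m.factorial : ℝ) * √(J / κ)) + M * ϱ₁ ^ m) := by
    intro m n N x κ J P hmn hκ hq hP hJ
    refine uniformError_le fun z hz => ?_
    have h1 := norm_eval_truncation_sub_le (m := m) hκ hq hP (hTdeg n) hJ (hB' z hz)
    rw [hTtrunc m n hmn] at h1
    have h2 : M * gauge K₀ z ^ m ≤ M * ϱ₁ ^ m := mul_le_mul_of_nonneg_left
      (pow_le_pow_left₀ (gauge_nonneg _) (gauge_le_supGauge hK₁' hz) m) hM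
    exact (norm_sub_le_norm_sub_add_norm_sub _ _ _).trans
      (add_le_add h1 ((hTerr m z (hK₁' hz)).trans h2))
  set A₀ := √(4 * Real.exp B) with hA₀
  have hA₀0 : 0 ≤ A₀ := Real.sqrt_nonneg _
  -- The first term serves the coefficient error, with `√8` from `κ = Λ / 8` in the random case; `M`
  -- serves the Taylor error on `K₁`, and `1` ensures positivity.
  refine ⟨A₀ * (√8 * M) + M + 1, by positivity, ?_, ?_⟩
  · intro x hx hw m n hmn P hP
    have hcont : ContinuousOn (fun y : Fin d → ℝ =>
        ‖MvPolynomial.eval (toComplex y) (T n) - g (toComplex y)‖ ^ 2) (realPart K₀) := by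
      refine ContinuousOn.pow (ContinuousOn.norm (ContinuousOn.sub ?_ ?_)) 2
      · exact ((MvPolynomial.continuous_eval (T n)).comp
          isometry_toComplex.continuous).continuousOn
      · exact hg.continuousOn.comp isometry_toComplex.continuous.continuousOn fun y hy => hy
    have hJ := tendsto_average_of_weaklyConverges hS hμ_supp hx hw hcont
    set J := ∫ y, ‖MvPolynomial.eval (toComplex y) (T n) - g (toComplex y)‖ ^ 2 ∂μ with hJdef
    have hJle : J ≤ (M * ϱ ^ n) ^ 2 := by
      have h := norm_integral_le_of_norm_le_const (μ := μ) (C := (M * ϱ ^ n) ^ 2)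
        (f := fun y => ‖MvPolynomial.eval (toComplex y) (T n) - g (toComplex y)‖ ^ 2)
        (by
          filter_upwards [(Measure.support_mem_ae : μ.support ∈ ae μ)] with y hy
          rw [Real.norm_of_nonneg (sq_nonneg _)]
          exact hTsupp n y hy)
      simpa using (le_abs_self _).trans h
    have hκ : Tendsto (fun N : ℕ => minEigenvalue n μ
        - ‖(N : ℝ)⁻¹ • ∑ i : Fin N, pointMoments n (x i) - ∫ y, pointMoments n y ∂μ‖) atTop
        (𝓝 (minEigenvalue n μ)) := by
      have h := (tendsto_average_pointMoments hS hμ_supp hx hw n).sub_const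
        (∫ y, pointMoments n y ∂μ)
      simpa using h.norm.const_sub (minEigenvalue n μ)
    have hlim := ((((hJ.div hκ (hΛ n).ne').sqrt.const_mul √(m.factorial : ℝ)).const_mul
      A₀).add_const (M * ϱ₁ ^ m))
    have hlim' := ENNReal.tendsto_ofReal hlim
    refine le_trans (limsup_le_limsup ?_)
      (hlim'.limsup_eq.trans_le (ENNReal.ofReal_le_ofReal ?_))
    -- The empirical lower bound `κ` is positive only for large `N`, which suffices for the limsup.
    · filter_upwards [hκ.eventually (lt_mem_nhds (hΛ n))] with N hN
      exact herr hmn hN (mul_sum_sq_le_sum_sq_div hS hμ_supp _) (hP N) le_rfl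
    have h1 : √(J / minEigenvalue n μ) ≤ M * (ϱ ^ n / √(minEigenvalue n μ)) := by
      rw [Real.sqrt_div' _ (hΛ n).le, ← mul_div_assoc]
      gcongr
      exact Real.sqrt_le_iff.2 ⟨by positivity, hJle⟩
    have h8 : (1 : ℝ) ≤ √8 := Real.one_le_sqrt.2 (by norm_num)
    set q := ϱ ^ n / √(minEigenvalue n μ)
    have hq0 : 0 ≤ q := by positivity
    have hp0 : 0 ≤ ϱ₁ ^ m := by positivity
    calc A₀ * (√(m.factorial : ℝ) * √(J / minEigenvalue n μ)) + M * ϱ₁ ^ m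
        ≤ A₀ * (√(m.factorial : ℝ) * (1 * M * q)) + M * ϱ₁ ^ m := by
          rw [one_mul]; gcongr
      _ ≤ A₀ * (√(m.factorial : ℝ) * (√8 * M * q)) + M * ϱ₁ ^ m := by gcongr
      _ = A₀ * (√8 * M) * (√(m.factorial : ℝ) * q) + M * ϱ₁ ^ m := by ring
      _ ≤ (A₀ * (√8 * M) + M + 1) * (√(m.factorial : ℝ) * q)
          + (A₀ * (√8 * M) + M + 1) * ϱ₁ ^ m := by
          gcongr
          · linarith
          · have : 0 ≤ A₀ * (√8 * M) := by positivity
            linarith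
      _ = _ := by ring
  · intro Ω _ ν _ δ hδ hδ1 m n N hmn hN X hX hind
    obtain ⟨A, hAm, hAν, hA⟩ :=
      exists_measurableSet_norm_sub_lt hS hμ_supp (hΛ n) hδ hδ1 hN hX hind
    refine ⟨A, hAm, hAν, fun ω hω P hP => ?_⟩
    obtain ⟨hXs, hXn⟩ := hA ω hω
    have hκ : 0 < minEigenvalue n μ / 8 := by have := hΛ n; positivity
    have hJ : (N : ℝ)⁻¹ * residual (fun i => X i ω) g (T n) ≤ (M * ϱ ^ n) ^ 2 := by
      have h : residual (fun i => X i ω) g (T n) ≤ N * (M * ϱ ^ n) ^ 2 := by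
        have := Finset.sum_le_card_nsmul (Finset.univ : Finset (Fin N)) _ _
          fun i _ => hTsupp n _ (hXs i)
        simpa [LSApprox.residual] using this
      refine (mul_le_mul_of_nonneg_left h (by positivity)).trans ?_
      rw [← mul_assoc]
      -- This covers `N = 0` as well, where the inverse is `0`.
      exact mul_le_of_le_one_left (sq_nonneg _) (inv_mul_le_one)
    refine (herr hmn hκ (fun c => ?_) hP hJ).trans (ENNReal.ofReal_le_ofReal ?_)
    · refine le_trans (mul_le_mul_of_nonneg_right ?_
        (Finset.sum_nonneg fun _ _ => sq_nonneg _))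
        (mul_sum_sq_le_sum_sq_div hS hμ_supp (fun i => X i ω) c)
      linarith
    have h1 : √((M * ϱ ^ n) ^ 2 / (minEigenvalue n μ / 8))
        = √8 * M * (ϱ ^ n / √(minEigenvalue n μ)) := by
      rw [div_div_eq_mul_div, Real.sqrt_div' _ (hΛ n).le, Real.sqrt_mul (sq_nonneg _),
        Real.sqrt_sq (by positivity)]
      ring
    rw [h1]
    have h2 : √(m.factorial : ℝ) ≤ √(2 * (m.factorial : ℝ)) :=
      Real.sqrt_le_sqrt (le_mul_of_one_le_left (Nat.cast_nonneg _) one_le_two)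
    set q := ϱ ^ n / √(minEigenvalue n μ)
    have hq0 : 0 ≤ q := by positivity
    have hp0 : 0 ≤ ϱ₁ ^ m := by positivity
    calc A₀ * (√(m.factorial : ℝ) * (√8 * M * q)) + M * ϱ₁ ^ m
        ≤ A₀ * (√(2 * (m.factorial : ℝ)) * (√8 * M * q)) + M * ϱ₁ ^ m := by gcongr
      _ = A₀ * (√8 * M) * (√(2 * (m.factorial : ℝ)) * q) + M * ϱ₁ ^ m := by ring
      _ ≤ (A₀ * (√8 * M) + M + 1) * (√(2 * (m.factorial : ℝ)) * q)
          + (A₀ * (√8 * M) + M + 1) * ϱ₁ ^ m := by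
          gcongr
          · linarith
          · have : 0 ≤ A₀ * (√8 * M) := by positivity
            linarith
      _ = _ := by ring
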